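/- **Setting.** Let $M$ be a compact smooth manifold without boundary. A *compatible pair* (almost Hermitian structure) $(\omega,J)$ on $M$ consists of a two-form $\omega$ and an almost complex structure $J$ ($J^2=-1$) with $\omega(J\cdot,J\cdot)=\omega(\cdot,\cdot)$ and $\omega(v,Jv)>0$ for $v\neq 0$; its almost Hermitian metric is $g(x,y)=\omega(x,Jy)$. Let $d^*$ be the formal adjoint of the exterior derivative $d$ for the $L^2$ inner products $(\alpha,\beta)=\int_M\langle\alpha,\beta\rangle_g\,dv_g$ on differential forms, that is, $(d^*\alpha,\beta)=(\alpha,d\beta)$ for all smooth forms $\beta$, and let $\mathrm{Ric}$ be the Ricci tensor of $g$. Define endomorphism fields $K_1=K_1(\omega,J)$ and $B=B(\omega,J)$ by $$g(K_1x,y)=\tfrac12\bigl(d^*d\omega(Jx,Jy)-d^*d\omega(x,y)\bigr),\qquad g(Bx,y)=\mathrm{Ric}(Jx,y)+\mathrm{Ric}(x,Jy).$$ Let $S\subset\mathbb R$ be an interval with more than one point and with $\min S=0$ (such as $[0,T)$, $[0,T]$ or $[0,\infty)$). A *smooth solution of the $d^*d$-Ricci flow* on $S$ is a family of compatible pairs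 $(\omega(t),J(t))$, $t\in S$, smooth on $S\times M$, with $$\frac{\partial\omega}{\partial t}+d^*d\omega=0,\qquad \frac{\partial J}{\partial t}=K_1(\omega,J)+B(\omega,J),$$ where $g$, $d^*$ and $\mathrm{Ric}$ at time $t$ are those of $(\omega(t),J(t))$. **Proposition.** Let $(\omega(t),J(t))$, $t\in S$, be a smooth solution of the $d^*d$-Ricci flow whose initial form $\omega_0=\omega(0)$ is symplectic, $d\omega_0=0$. Then $\omega(t)=\omega_0$ for all $t\in S$, and the flow reduces to the anti-complexified Ricci flow on $(M,\omega_0)$: the $J(t)$ are almost complex structures compatible with $\omega_0$, smooth on $S\times M$, with $$\frac{\partial J}{\partial t}=B(\omega_0,J).$$ Conversely, if $\omega_0$ is a smooth two-form with $d\omega_0=0$ and $J(t)$, $t\in S$, is a smooth family of almost complex structures compatible with $\omega_0$ that solves $\partial_tJ=B(\omega_0,J)$, then $(\omega_0,J(t))$ is a smooth solution of the $d^*d$-Ricci flow. -/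

import Mathlib

open Set MeasureTheory
open scoped Manifold

noncomputable section

namespace AlmostHermitian

/-- The model space `ℝᵐ` (with the Euclidean norm and Lebesgue measure). -/
abbrev Model (m : ℕ) : Type := EuclideanSpace ℝ (Fin m)

/-- The standard basis vector `e_i` of the model space. -/
def stdVec {m : ℕ} (i : Fin m) : Model m := EuclideanSpace.single i 1

/-! ### Linear algebra and coordinate calculus on the model space -/

/-- The inner product of two `p`-covectors induced by the inner product with Gram matrix `G`
in the standard basis, normalized so that the `e^{i₁} ∧ ⋯ ∧ e^{i_p}` with `i₁ < ⋯ < i_p` are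
orthonormal when `G = 1`:
`⟨α, β⟩ = (1/p!) ∑ G^{i₁ j₁} ⋯ G^{i_p j_p} α_{i₁ … i_p} β_{j₁ … j_p}`. -/
def formInner {m p : ℕ} (G : Matrix (Fin m) (Fin m) ℝ) (α β : Model m [⋀^Fin p]→L[ℝ] ℝ) : ℝ :=
  ((p.factorial : ℝ))⁻¹ * ∑ a : Fin p → Fin m, ∑ b : Fin p → Fin m,
    (∏ k, G⁻¹ (a k) (b k)) * α (fun k => stdVec (a k)) * β (fun k => stdVec (b k))

/-- The partial derivative `∂_k f`. -/
def partialDeriv {m : ℕ} (k : Fin m) (f : Model m → ℝ) (u : Model m) : ℝ :=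
  fderiv ℝ f u (stdVec k)

/-- The Christoffel symbol `Γ^k_{ij} = ½ G^{kl} (∂_i G_{jl} + ∂_j G_{il} - ∂_l G_{ij})` of the
Levi-Civita connection of the metric `G_{ij}`. -/
def christoffel {m : ℕ} (G : Model m → Matrix (Fin m) (Fin m) ℝ) (k i j : Fin m)
    (u : Model m) : ℝ :=
  (1 / 2 : ℝ) * ∑ l, (G u)⁻¹ k l *
    (partialDeriv i (fun w => G w j l) u + partialDeriv j (fun w => G w i l) u
      - partialDeriv l (fun w => G w i j) u)

/-- The components of the Ricci tensor of the metric `G_{ij}`: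
`R_{jk} = ∂_i Γ^i_{jk} - ∂_j Γ^i_{ik} + Γ^i_{il} Γ^l_{jk} - Γ^i_{jl} Γ^l_{ik}`. -/
def ricciCoord {m : ℕ} (G : Model m → Matrix (Fin m) (Fin m) ℝ) (u : Model m)
    (j k : Fin m) : ℝ :=
  ∑ i, (partialDeriv i (christoffel G i j k) u - partialDeriv j (christoffel G i i k) u
    + ∑ l, (christoffel G i i l u * christoffel G l j k u
      - christoffel G i j l u * christoffel G l i k u))

/-! ### Tensor fields on a manifold and their expressions in charts -/

section Manifold

variable {m : ℕ} {M : Type*} [TopologicalSpace M] [ChartedSpace (Model m) M]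

/-- The tangent space `T_x M`. -/
abbrev Tan (m : ℕ) {M : Type*} [TopologicalSpace M] [ChartedSpace (Model m) M] (x : M) : Type :=
  TangentSpace 𝓘(ℝ, Model m) x

/-- (Not necessarily continuous) fields of alternating `p`-forms on `M`. -/
abbrev FormField (m p : ℕ) (M : Type*) [TopologicalSpace M] [ChartedSpace (Model m) M] :
    Type _ :=
  ∀ x : M, Tan m x [⋀^Fin p]→L[ℝ] ℝ

/-- (Not necessarily continuous) fields of endomorphisms of the tangent spaces. -/
abbrev EndoField (m : ℕ) (M : Type*) [TopologicalSpace M] [ChartedSpace (Model m) M] :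
    Type _ :=
  ∀ x : M, Tan m x →L[ℝ] Tan m x

/-- Fields of (bilinear) functions of two tangent vectors. -/
abbrev BilinField (m : ℕ) (M : Type*) [TopologicalSpace M] [ChartedSpace (Model m) M] :
    Type _ :=
  ∀ x : M, Tan m x → Tan m x → ℝ

/-- The chart `φ_c` around the point `c`. -/
abbrev chart (m : ℕ) {M : Type*} [TopologicalSpace M] [ChartedSpace (Model m) M] (c : M) :
    PartialEquiv M (Model m) :=
  extChartAt 𝓘(ℝ, Model m) c

/-- The differential `D φ_c (x) : T_x M → ℝᵐ` of the chart around `c`. -/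
def chartDiff (c x : M) : Tan m x →L[ℝ] Model m :=
  mfderiv 𝓘(ℝ, Model m) 𝓘(ℝ, Model m) (chart m c) x

/-- The differential `D φ_c⁻¹ (u) : ℝᵐ → T M` of the inverse of the chart around `c`; it sends
`e_i` to the coordinate vector field `∂_i`. -/
def chartFrame (c : M) (u : Model m) : Model m →L[ℝ] Tan m ((chart m c).symm u) :=
  mfderiv 𝓘(ℝ, Model m) 𝓘(ℝ, Model m) (chart m c).symm u

/-- The expression `(φ_c⁻¹)^* η` of a `p`-form in the chart around `c`. -/
def chartForm {p : ℕ} (c : M) (η : FormField m p M) (u : Model m) : Model m [⋀^Fin p]→L[ℝ] ℝ :=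
  (η ((chart m c).symm u)).compContinuousLinearMap (chartFrame c u)

/-- The expression of a field of endomorphisms in the chart around `c`. -/
def chartEndo (c : M) (A : EndoField m M) (u : Model m) : Model m →L[ℝ] Model m :=
  (chartDiff c ((chart m c).symm u)).comp ((A ((chart m c).symm u)).comp (chartFrame c u))

/-- The matrix `g_{ij} = g(∂_i, ∂_j)` in the chart around `c`. -/
def chartGram (c : M) (g : BilinField m M) (u : Model m) : Matrix (Fin m) (Fin m) ℝ :=
  Matrix.of fun i j =>
    g ((chart m c).symm u) (chartFrame c u (stdVec i)) (chartFrame c u (stdVec j))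

/-- Smooth differential `p`-forms. -/
def IsSmoothForm {p : ℕ} (η : FormField m p M) : Prop :=
  ∀ c : M, ContDiffOn ℝ ((⊤ : ℕ∞) : WithTop ℕ∞) (chartForm c η) (chart m c).target

/-- Families of `p`-forms that are smooth in space and time, `(t, x) ∈ S × M`. -/
def IsSmoothFormFamily {p : ℕ} (S : Set ℝ) (η : ℝ → FormField m p M) : Prop :=
  ∀ c : M, ContDiffOn ℝ ((⊤ : ℕ∞) : WithTop ℕ∞) (fun q : ℝ × Model m => chartForm c (η q.1) q.2)
    (S ×ˢ (chart m c).target)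

/-- Families of endomorphism fields that are smooth in space and time, `(t, x) ∈ S × M`. -/
def IsSmoothEndoFamily (S : Set ℝ) (A : ℝ → EndoField m M) : Prop :=
  ∀ c : M, ContDiffOn ℝ ((⊤ : ℕ∞) : WithTop ℕ∞) (fun q : ℝ × Model m => chartEndo c (A q.1) q.2)
    (S ×ˢ (chart m c).target)

/-- The exterior derivative `dη`; at `x` it is computed in the chart around `x`. -/
def extD {p : ℕ} (η : FormField m p M) : FormField m (p + 1) M := fun x =>
  (extDeriv (chartForm x η) (chart m x x)).compContinuousLinearMap (chartDiff x x)

/-- The Ricci tensor of the Riemannian metric `g`; at `x` it is computed in the chart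
around `x`. -/
def ricci (g : BilinField m M) : BilinField m M := fun x v w =>
  ∑ j, ∑ k, ricciCoord (chartGram x g) (chart m x x) j k * chartDiff x x v j * chartDiff x x w k

/-- A basis of `T_x M` (which Mathlib identifies with the model space). -/
def tanBasis (x : M) : Module.Basis (Fin m) ℝ (Tan m x) :=
  (EuclideanSpace.basisFun (Fin m) ℝ).toBasis

/-- The endomorphism field `K` with `g(K v, w) = b(v, w)`, i.e. `K^k_j = g^{kl} b_{jl}`. -/
def raise (g b : BilinField m M) (x : M) (v : Tan m x) : Tan m x :=
  ∑ k, (∑ l, (Matrix.of fun i j => g x (tanBasis x i) (tanBasis x j))⁻¹ k l *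
    b x v (tanBasis x l)) • tanBasis x k

/-! ### Almost Hermitian structures -/

/-- The pair `(ω, J)` is an almost Hermitian structure: `J` is an almost complex structure and
`ω` is compatible with `J`, i.e. `J` preserves `ω` and `ω(v, J v) > 0` for `v ≠ 0`. -/
structure IsCompatiblePair (ω : FormField m 2 M) (J : EndoField m M) : Prop where
  sq_eq_neg : ∀ (x : M) (v : Tan m x), J x (J x v) = -v
  invariant : ∀ (x : M) (v w : Tan m x), ω x ![J x v, J x w] = ω x ![v, w]
  pos : ∀ (x : M) (v : Tan m x), v ≠ 0 → 0 < ω x ![v, J x v]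

/-- The almost Hermitian metric `g(v, w) = ω(v, J w)`. -/
def metric (ω : FormField m 2 M) (J : EndoField m M) : BilinField m M := fun x v w =>
  ω x ![v, J x w]

/-- The defining property of `raise`, for the metric of a compatible pair. -/
theorem metric_raise {ω : FormField m 2 M} {J : EndoField m M} (h : IsCompatiblePair ω J)
    (b : BilinField m M) (x : M) (v : Tan m x) (hb : IsLinearMap ℝ (b x v)) (w : Tan m x) :
    metric ω J x (raise (metric ω J) b x v) w = b x v w := by
  classical
  let e : Module.Basis (Fin m) ℝ (Tan m x) := tanBasis x
  set G : Matrix (Fin m) (Fin m) ℝ := Matrix.of fun i j => metric ω J x (e i) (e j) with hG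
  have up0 : ∀ p q r : Tan m x, Function.update ![p, q] 0 r = ![r, q] := by
    intro p q r
    ext k : 1
    fin_cases k <;> rfl
  have up1 : ∀ p q r : Tan m x, Function.update ![p, q] 1 r = ![p, r] := by
    intro p q r
    ext k : 1
    fin_cases k <;> rfl
  have hadd : ∀ u u' z, metric ω J x (u + u') z = metric ω J x u z + metric ω J x u' z := by
    intro u u' z
    have := (ω x).map_update_add ![u, J x z] 0 u u'
    simpa only [metric, up0, up1, map_add, map_smul, smul_eq_mul] using this
  have hsmul : ∀ (r : ℝ) u z, metric ω J x (r • u) z = r * metric ω J x u z := by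
    intro r u z
    have := (ω x).map_update_smul ![u, J x z] 0 r u
    simpa only [metric, up0, up1, map_add, map_smul, smul_eq_mul] using this
  have hadd' : ∀ z u u', metric ω J x z (u + u') = metric ω J x z u + metric ω J x z u' := by
    intro z u u'
    have := (ω x).map_update_add ![z, J x u] 1 (J x u) (J x u')
    simpa only [metric, up0, up1, map_add, map_smul, smul_eq_mul] using this
  have hsmul' : ∀ (r : ℝ) z u, metric ω J x z (r • u) = r * metric ω J x z u := by
    intro r z u
    have := (ω x).map_update_smul ![z, J x u] 1 r (J x u)
    simpa only [metric, up0, up1, map_add, map_smul, smul_eq_mul] using this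
  let g : Tan m x →ₗ[ℝ] Tan m x →ₗ[ℝ] ℝ :=
    LinearMap.mk₂ ℝ (metric ω J x) hadd hsmul hadd' hsmul'
  have hg : ∀ u z, metric ω J x u z = g u z := fun u z => rfl
  have hinj : Function.Injective G.vecMul := by
    rw [← Matrix.coe_vecMulLinear, ← LinearMap.ker_eq_bot, LinearMap.ker_eq_bot']
    intro c hc
    have h1 : ∀ j, g (∑ i, c i • e i) (e j) = 0 := by
      intro j
      have := congrFun hc j
      simpa [Matrix.vecMul, dotProduct, hG, hg] using this
    have h2 : g (∑ i, c i • e i) = 0 := e.ext (by simpa using h1)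
    have h3 : ∑ i, c i • e i = 0 := by
      by_contra hne
      have := h.pos x _ hne
      have h4 := congrArg (fun f => f (∑ i, c i • e i)) h2
      simp only [LinearMap.zero_apply] at h4
      rw [← hg] at h4
      exact absurd h4 this.ne'
    exact funext fun i => (Fintype.linearIndependent_iff.1 e.linearIndependent) c h3 i
  have hdet : IsUnit G.det :=
    (Matrix.isUnit_iff_isUnit_det G).1 (Matrix.vecMul_injective_iff_isUnit.1 hinj)
  let bl : Tan m x →ₗ[ℝ] ℝ := hb.mk' _
  have hbl : ∀ z, b x v z = bl z := fun z => rfl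
  have hswap : ∀ p q : Tan m x, ω x ![p, q] = -ω x ![q, p] := by
    intro p q
    have := (ω x).map_swap ![q, p] (i := 0) (j := 1) (by decide)
    refine Eq.trans (congrArg (ω x) ?_) this
    ext k : 1
    fin_cases k <;> rfl
  have hsymm : ∀ i j, G i j = G j i := by
    intro i j
    change ω x ![e i, J x (e j)] = ω x ![e j, J x (e i)]
    rw [← h.invariant x (e j) (J x (e i)), h.sq_eq_neg, hswap]
    have := (ω x).map_update_smul ![J x (e j), e i] 1 (-1) (e i)
    simp only [up1, neg_smul, one_smul] at this
    exact this.symm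
  have key : g (raise (metric ω J) b x v) = bl := by
    refine e.ext fun j => ?_
    have h1 : g (raise (metric ω J) b x v) (e j) =
        ∑ k, (∑ l, G⁻¹ k l * bl (e l)) * G k j := by
      simp only [raise, map_sum, map_smul, LinearMap.sum_apply, LinearMap.smul_apply, smul_eq_mul]
      rfl
    have h2 : (G * G⁻¹).mulVec (fun l => bl (e l)) j = bl (e j) := by
      rw [Matrix.mul_nonsing_inv G hdet, Matrix.one_mulVec]
    rw [h1, ← h2, ← Matrix.mulVec_mulVec]
    simp only [Matrix.mulVec, dotProduct]
    exact Finset.sum_congr rfl fun k _ => by rw [hsymm k j, mul_comm]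
  rw [hg, key]
  rfl

/-- The endomorphism field `K₁`, given by `g(K₁ v, w) = ½ (γ(J v, J w) - γ(v, w))`, where the
two-form `γ` is to be `d^* d ω`. -/
def fieldK (ω : FormField m 2 M) (J : EndoField m M) (γ : FormField m 2 M) (x : M) :
    Tan m x → Tan m x :=
  raise (metric ω J) (fun x v w => (1 / 2 : ℝ) * (γ x ![J x v, J x w] - γ x ![v, w])) x

/-- The endomorphism field `B(ω, J)`, given by `g(B v, w) = Ric(J v, w) + Ric(v, J w)`, where
`Ric` is the Ricci tensor of `g`. -/
def fieldB (ω : FormField m 2 M) (J : EndoField m M) (x : M) : Tan m x → Tan m x :=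
  raise (metric ω J)
    (fun x v w => ricci (metric ω J) x (J x v) w + ricci (metric ω J) x v (J x w)) x

end Manifold

/-! ### Integration, the operator `d^*`, and the flows -/

section Flow

variable {m : ℕ} {M : Type*} [TopologicalSpace M] [T2Space M] [CompactSpace M]
  [ChartedSpace (Model m) M] [IsManifold 𝓘(ℝ, Model m) ((⊤ : ℕ∞) : WithTop ℕ∞) M]

/-- A smooth partition of unity subordinate to the chart domains. -/
def chartPartition (m : ℕ) (M : Type*) [TopologicalSpace M] [T2Space M] [CompactSpace M]
    [ChartedSpace (Model m) M] [IsManifold 𝓘(ℝ, Model m) ((⊤ : ℕ∞) : WithTop ℕ∞) M] :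
    SmoothPartitionOfUnity M 𝓘(ℝ, Model m) M univ :=
  Classical.choose
    (SmoothPartitionOfUnity.exists_isSubordinate_chartAt_source 𝓘(ℝ, Model m) M)

/-- The `L²` inner product `(α, β) = ∫_M ⟨α, β⟩ dv_g` of `p`-forms, where `dv_g` is the Riemannian
volume `√(det g_{ij}) du`, which is `ωⁿ / n!` if `g` comes from a compatible pair `(ω, J)` in
dimension `2n`. The integral is computed in the charts `φ_c`, by means of a partition of unity. -/
def l2Inner {p : ℕ} (g : BilinField m M) (α β : FormField m p M) : ℝ :=
  ∑ᶠ c : M, ∫ u in (chart m c).target,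
    chartPartition m M c ((chart m c).symm u) *
      formInner (chartGram c g u) (chartForm c α u) (chartForm c β u) *
      √(chartGram c g u).det

/-- `γ = d^* α`: the smooth `p`-form `γ` satisfies `(γ, β) = (α, dβ)` for every smooth
`p`-form `β`. There is at most one such `γ`. -/
def IsCodifferential {p : ℕ} (g : BilinField m M) (α : FormField m (p + 1) M)
    (γ : FormField m p M) : Prop :=
  IsSmoothForm γ ∧ ∀ β : FormField m p M, IsSmoothForm β → l2Inner g γ β = l2Inner g α (extD β)

/-- `(ω, J)` is a smooth solution on the time interval `S` of the `d^* d`-Ricci flow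
`∂_t ω + d^* d ω = 0`, `∂_t J = K₁(ω, J) + B(ω, J)` of almost Hermitian structures.
Here `γ` is the form `d^* d ω` at time `t`. -/
structure IsDStarDRicciFlow (S : Set ℝ) (ω : ℝ → FormField m 2 M) (J : ℝ → EndoField m M) :
    Prop where
  smooth_form : IsSmoothFormFamily S ω
  smooth_endo : IsSmoothEndoFamily S J
  compatible : ∀ t ∈ S, IsCompatiblePair (ω t) (J t)
  evolution : ∀ t ∈ S, ∃ γ : FormField m 2 M,
    IsCodifferential (metric (ω t) (J t)) (extD (ω t)) γ ∧
    (∀ (x : M) (v : Fin 2 → Tan m x),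
      HasDerivWithinAt (fun s => ω s x v) (-(γ x v)) S t) ∧
    (∀ (x : M) (v : Tan m x),
      HasDerivWithinAt (fun s => J s x v) (fieldK (ω t) (J t) γ x v + fieldB (ω t) (J t) x v) S t)

/-- `J` is a smooth solution on the time interval `S` of the anti-complexified Ricci flow
`∂_t J = B(ω₀, J)` of almost complex structures compatible with the symplectic form `ω₀`. -/
structure IsAntiComplexifiedRicciFlow (S : Set ℝ) (ω₀ : FormField m 2 M)
    (J : ℝ → EndoField m M) : Prop where
  smooth_form : IsSmoothForm ω₀
  closed : extD ω₀ = 0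
  smooth_endo : IsSmoothEndoFamily S J
  compatible : ∀ t ∈ S, IsCompatiblePair ω₀ (J t)
  evolution : ∀ t ∈ S, ∀ (x : M) (v : Tan m x),
    HasDerivWithinAt (fun s => J s x v) (fieldB ω₀ (J t) x v) S t

end Flow

end AlmostHermitian

end

open AlmostHermitian

/-! Closedness is preserved by an energy estimate. Let `E(t)` be the squared `L²` norm of `dω(t)`
with respect to the metric at time `t`. Its derivative has two parts. The part from `∂_t ω = -γ`,
where `γ = d^*dω`, is `2(dω, d(-γ)) = -2(γ, γ) ≤ 0`, by the very definition of the codifferential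
tested on the smooth form `-γ`. The part from the moving metric and volume is a quadratic form in
`dω` with bounded coefficients, hence at most `C · E` on a compact time interval. So `E' ≤ C E` with
`E(0) = 0`, and Grönwall gives `E = 0`. No parabolic theory and no evolution equation for the metric
is needed, only smoothness of the family in space and time.

Once `dω = 0`, testing `γ` against itself gives `γ = 0`; then `K₁ = 0`, `ω` is constant in time and
the equation for `J` is the anti-complexified Ricci flow. The converse takes `γ = 0`.

The estimate rests on `extD_eq_zero_of_flow`, which combines `exists_hasDerivAt_innerDensity_le`
(pointwise inequality in a chart), `hasDerivAt_chartForm_extD` (`d` commutes with `∂_t`),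
`hasDerivAt_setIntegral_of_isCompact_support` (differentiation under the integral) and
`eq_zero_of_l2Inner_self` (definiteness of the `L²` product). -/

open AlmostHermitian

namespace AlmostHermitian

/-! ### Positivity of the inner product of covectors -/

section LinearAlgebra

open Matrix

/-- The `p`-fold Kronecker power of a matrix. -/
def kroneckerPow {n : Type*} (p : ℕ) (A : Matrix n n ℝ) :
    Matrix (Fin p → n) (Fin p → n) ℝ :=
  Matrix.of fun a b => ∏ k, A (a k) (b k)

variable {n : Type*} {p : ℕ}

theorem kroneckerPow_mul [Fintype n] (A B : Matrix n n ℝ) :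
    kroneckerPow p (A * B) = kroneckerPow p A * kroneckerPow p B := by
  ext a b
  simp only [kroneckerPow, Matrix.of_apply, Matrix.mul_apply, ← Finset.prod_mul_distrib]
  rw [Finset.prod_univ_sum, Fintype.piFinset_univ]

theorem kroneckerPow_one [DecidableEq n] : kroneckerPow p (1 : Matrix n n ℝ) = 1 := by
  ext a b
  simp only [kroneckerPow, Matrix.of_apply, Matrix.one_apply, Finset.prod_ite_zero,
    Finset.prod_const_one, Finset.mem_univ, true_implies, funext_iff]

theorem kroneckerPow_conjTranspose (A : Matrix n n ℝ) :
    kroneckerPow p Aᴴ = (kroneckerPow p A)ᴴ := by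
  ext a b
  simp [kroneckerPow]

open scoped MatrixOrder in
-- Multiplicativity carries the factorization `A = RᴴR`, with `R` the square root of `A`, to the
-- power, which is therefore positive semidefinite. It is also invertible, with inverse the power of
-- `A⁻¹`.
theorem kroneckerPow_posDef [Fintype n] [DecidableEq n] {A : Matrix n n ℝ} (hA : A.PosDef) : (kroneckerPow p A).PosDef := by
  have hsq : A = (CFC.sqrt A)ᴴ * CFC.sqrt A := by
    have h := (CFC.sqrt_nonneg A).posSemidef.isHermitian
    rw [h.eq, CFC.sqrt_mul_sqrt_self A hA.posSemidef.nonneg]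
  have hpsd : (kroneckerPow p A).PosSemidef := by
    rw [hsq, kroneckerPow_mul, kroneckerPow_conjTranspose]
    exact posSemidef_conjTranspose_mul_self _
  have hdet : IsUnit A.det := (Matrix.isUnit_iff_isUnit_det A).1 hA.isUnit
  rw [hpsd.posDef_iff_isUnit]
  refine IsUnit.of_mul_eq_one (kroneckerPow p A⁻¹) ?_
  rw [← kroneckerPow_mul, Matrix.mul_nonsing_inv A hdet, kroneckerPow_one]

/-- A quadratic form depending continuously on a parameter in a compact set is bounded by any
positive definite one. -/
theorem exists_quadraticForm_le {X ι : Type*} [TopologicalSpace X] [Fintype ι] {K : Set X}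
    (hK : IsCompact K) {P Q : X → Matrix ι ι ℝ}
    (hP : ∀ a b, ContinuousOn (fun x => P x a b) K)
    (hQ : ∀ a b, ContinuousOn (fun x => Q x a b) K) (hpos : ∀ x ∈ K, (P x).PosDef) :
    ∃ C : ℝ, ∀ x ∈ K, ∀ v : ι → ℝ, v ⬝ᵥ Q x *ᵥ v ≤ C * (v ⬝ᵥ P x *ᵥ v) := by
  have hcont : ∀ R : X → Matrix ι ι ℝ, (∀ a b, ContinuousOn (fun x => R x a b) K) →
      ContinuousOn (fun q : X × (ι → ℝ) => q.2 ⬝ᵥ R q.1 *ᵥ q.2) (K ×ˢ Metric.sphere 0 1) := by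
    intro R hR
    simp only [dotProduct, Matrix.mulVec]
    refine continuousOn_finsetSum _ fun a _ => ContinuousOn.mul (by fun_prop) ?_
    refine continuousOn_finsetSum _ fun b _ => ContinuousOn.mul ?_ (by fun_prop)
    exact (hR a b).comp continuousOn_fst fun q hq => hq.1
  have hposv : ∀ x ∈ K, ∀ v : ι → ℝ, v ≠ 0 → 0 < v ⬝ᵥ P x *ᵥ v := fun x hx v hv => by
    simpa using (hpos x hx).dotProduct_mulVec_pos hv
  have hne : ∀ v ∈ Metric.sphere (0 : ι → ℝ) 1, v ≠ 0 := by
    rintro v hv rfl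
    simp at hv
  -- `C` bounds the quotient of the two forms on the compact set `K × sphere`; both forms are
  -- homogeneous of degree two, so the bound extends to all vectors.
  obtain ⟨C, hC⟩ := (hK.prod (isCompact_sphere (0 : ι → ℝ) 1)).bddAbove_image
    ((hcont Q hQ).div (hcont P hP) fun q hq => (hposv q.1 hq.1 q.2 (hne q.2 hq.2)).ne')
  refine ⟨C, fun x hx v => ?_⟩
  rcases eq_or_ne v 0 with rfl | hv
  · simp
  have hv' : ‖v‖ ≠ 0 := norm_ne_zero_iff.2 hv
  have hmem : ‖v‖⁻¹ • v ∈ Metric.sphere (0 : ι → ℝ) 1 := by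
    simp [norm_smul, hv']
  have h := hC ⟨(x, ‖v‖⁻¹ • v), ⟨hx, hmem⟩, rfl⟩
  simp only [Pi.div_apply] at h
  rw [div_le_iff₀ (hposv x hx _ (hne _ hmem))] at h
  simp only [Matrix.mulVec_smul, dotProduct_smul, smul_dotProduct, smul_eq_mul] at h
  have h2 : 0 < ‖v‖⁻¹ * ‖v‖⁻¹ := by positivity
  nlinarith

variable {m : ℕ}

/-- The components `α(e_{i₁}, …, e_{i_p})` of a covector. -/
noncomputable def components (α : Model m [⋀^Fin p]→L[ℝ] ℝ) : (Fin p → Fin m) → ℝ :=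
  fun a => α fun k => stdVec (a k)

@[simp]
theorem components_neg (α : Model m [⋀^Fin p]→L[ℝ] ℝ) : components (-α) = -components α := rfl

@[simp]
theorem components_zero : components (0 : Model m [⋀^Fin p]→L[ℝ] ℝ) = 0 := rfl

theorem components_eq_zero {α : Model m [⋀^Fin p]→L[ℝ] ℝ} (h : components α = 0) : α = 0 := by
  have h2 : α.toMultilinearMap = 0 := by
    refine Module.Basis.ext_multilinear (fun _ => (EuclideanSpace.basisFun (Fin m) ℝ).toBasis)
      fun a => ?_
    have := congrFun h a
    simpa [components, stdVec] using this
  ext v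
  exact congrArg (fun f => f v) h2

/-- Multilinear expansion in the standard basis. It reduces smoothness of an evaluation, with
covector and vectors both varying, to that of a polynomial in their components. -/
theorem apply_eq_sum_components (α : Model m [⋀^Fin p]→L[ℝ] ℝ) (v : Fin p → Model m) :
    α v = ∑ a : Fin p → Fin m, (∏ k, v k (a k)) * components α a := by
  have hv : v = fun k => ∑ j, v k j • stdVec j := by
    ext k : 1
    simpa [stdVec] using ((EuclideanSpace.basisFun (Fin m) ℝ).sum_repr (v k)).symm
  conv_lhs => rw [hv]
  refine (α.toMultilinearMap.map_sum _).trans (Finset.sum_congr rfl fun a _ => ?_)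
  exact α.toMultilinearMap.map_smul_univ _ _

/-- The Gram matrix of the inner product `formInner G`, times the volume density. -/
noncomputable def densityGram (p : ℕ) (G : Matrix (Fin m) (Fin m) ℝ) :
    Matrix (Fin p → Fin m) (Fin p → Fin m) ℝ :=
  (√G.det * ((p.factorial : ℝ))⁻¹) • kroneckerPow p G⁻¹

/-- Absorbing the volume density into the Gram matrix lets the variation of metric and volume be
treated together, as the variation of one quadratic form. -/
theorem formInner_mul_sqrt_det (G : Matrix (Fin m) (Fin m) ℝ) (α β : Model m [⋀^Fin p]→L[ℝ] ℝ) :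
    formInner G α β * √G.det = components α ⬝ᵥ densityGram p G *ᵥ components β := by
  simp only [formInner, densityGram, kroneckerPow, dotProduct, Matrix.mulVec, components,
    Matrix.smul_apply, Matrix.of_apply, smul_eq_mul, Finset.mul_sum, Finset.sum_mul]
  exact Finset.sum_congr rfl fun a _ => Finset.sum_congr rfl fun b _ => by ring

theorem densityGram_posDef {G : Matrix (Fin m) (Fin m) ℝ} (hG : G.PosDef) :
    (densityGram p G).PosDef := by
  have := hG.det_pos
  exact (kroneckerPow_posDef hG.inv).smul (by positivity)

theorem dotProduct_densityGram_nonneg {G : Matrix (Fin m) (Fin m) ℝ} (hG : G.PosDef)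
    (v : (Fin p → Fin m) → ℝ) : 0 ≤ v ⬝ᵥ densityGram p G *ᵥ v := by
  simpa using (densityGram_posDef hG).posSemidef.dotProduct_mulVec_nonneg v

end LinearAlgebra

/-! ### Smooth dependence on parameters -/

section Smooth

open Matrix

variable {E : Type*} [NormedAddCommGroup E] [NormedSpace ℝ E] {k : WithTop ℕ∞} {s : Set E}
  {n : Type*} [Fintype n] [DecidableEq n] {m p : ℕ}

theorem contDiffOn_det {A : E → Matrix n n ℝ}
    (hA : ∀ i j, ContDiffOn ℝ k (fun x => A x i j) s) :
    ContDiffOn ℝ k (fun x => (A x).det) s := by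
  simp only [Matrix.det_apply']
  exact ContDiffOn.sum fun σ _ => contDiffOn_const.mul (contDiffOn_prod fun i _ => hA _ _)

/-- Cramer's rule: an entry of the adjugate is the determinant of `A` with one row replaced by a
constant one. -/
theorem contDiffOn_inv_apply {A : E → Matrix n n ℝ}
    (hA : ∀ i j, ContDiffOn ℝ k (fun x => A x i j) s) (hdet : ∀ x ∈ s, (A x).det ≠ 0) (i j : n) :
    ContDiffOn ℝ k (fun x => (A x)⁻¹ i j) s := by
  simp only [Matrix.inv_def, Matrix.smul_apply, Ring.inverse_eq_inv', smul_eq_mul,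
    Matrix.adjugate_apply]
  refine ((contDiffOn_det hA).inv hdet).mul (contDiffOn_det fun a b => ?_)
  by_cases h : a = j
  · subst h
    simpa using contDiffOn_const
  · simpa [Matrix.updateRow_ne h] using hA a b

theorem contDiffOn_densityGram {G : E → Matrix (Fin m) (Fin m) ℝ}
    (hG : ∀ i j, ContDiffOn ℝ k (fun x => G x i j) s) (hpos : ∀ x ∈ s, (G x).PosDef)
    (a b : Fin p → Fin m) : ContDiffOn ℝ k (fun x => densityGram p (G x) a b) s := by
  have hdet : ∀ x ∈ s, (G x).det ≠ 0 := fun x hx => (hpos x hx).det_pos.ne'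
  simp only [densityGram, kroneckerPow, Matrix.smul_apply, Matrix.of_apply, smul_eq_mul]
  exact (((contDiffOn_det hG).sqrt hdet).mul contDiffOn_const).mul
    (contDiffOn_prod fun i _ => contDiffOn_inv_apply hG hdet _ _)

theorem contDiffOn_components {f : E → Model m [⋀^Fin p]→L[ℝ] ℝ} (hf : ContDiffOn ℝ k f s)
    (a : Fin p → Fin m) : ContDiffOn ℝ k (fun x => components (f x) a) s :=
  (ContinuousAlternatingMap.apply ℝ (Model m) ℝ fun i => stdVec (a i)).contDiff.comp_contDiffOn hf

theorem contDiffOn_form_apply {f : E → Model m [⋀^Fin p]→L[ℝ] ℝ} {v : E → Fin p → Model m}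
    (hf : ContDiffOn ℝ k f s) (hv : ∀ i, ContDiffOn ℝ k (fun x => v x i) s) :
    ContDiffOn ℝ k (fun x => f x (v x)) s := by
  simp only [apply_eq_sum_components]
  refine ContDiffOn.sum fun a _ => ContDiffOn.mul (contDiffOn_prod fun i _ => ?_)
    (contDiffOn_components hf a)
  exact (EuclideanSpace.proj (𝕜 := ℝ) (a i)).contDiff.comp_contDiffOn (hv i)

end Smooth

/-! ### Charts -/

section Charts

variable {m p : ℕ} {M : Type*} [TopologicalSpace M] [ChartedSpace (Model m) M]

theorem isOpen_chart_target (c : M) : IsOpen (chart m c).target :=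
  isOpen_extChartAt_target c

theorem IsSmoothFormFamily.isSmoothForm {S : Set ℝ} {η : ℝ → FormField m p M}
    (h : IsSmoothFormFamily S η) {t : ℝ} (ht : t ∈ S) : IsSmoothForm (η t) := fun c =>
  (h c).comp (contDiff_prodMk_right t).contDiffOn fun _ hu => ⟨ht, hu⟩

theorem IsSmoothForm.differentiableAt {η : FormField m p M} (h : IsSmoothForm η) (c : M)
    {u : Model m} (hu : u ∈ (chart m c).target) : DifferentiableAt ℝ (chartForm c η) u :=
  ((h c).contDiffAt ((isOpen_chart_target c).mem_nhds hu)).differentiableAt (by simp)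

theorem isSmoothForm_zero : IsSmoothForm (0 : FormField m p M) := fun c => by
  have : chartForm c (0 : FormField m p M) = fun _ => 0 := by
    ext u v
    rfl
  rw [this]
  exact contDiffOn_const

variable [IsManifold 𝓘(ℝ, Model m) ((⊤ : ℕ∞) : WithTop ℕ∞) M]

theorem chartDiff_comp_chartFrame (c : M) {u : Model m} (hu : u ∈ (chart m c).target) :
    (chartDiff c ((chart m c).symm u)).comp (chartFrame c u) = ContinuousLinearMap.id ℝ _ := by
  have := mfderiv_extChartAt_comp_mfderivWithin_extChartAt_symm (I := 𝓘(ℝ, Model m)) hu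
  rwa [ModelWithCorners.range_eq_univ, mfderivWithin_univ] at this

theorem chartFrame_comp_chartDiff (c : M) {u : Model m} (hu : u ∈ (chart m c).target) :
    (chartFrame c u).comp (chartDiff c ((chart m c).symm u)) = ContinuousLinearMap.id ℝ _ := by
  have := mfderivWithin_extChartAt_symm_comp_mfderiv_extChartAt (I := 𝓘(ℝ, Model m)) hu
  rwa [ModelWithCorners.range_eq_univ, mfderivWithin_univ] at this

theorem chartForm_comp_chartDiff (η : FormField m p M) (c : M) {y : M}
    (hy : y ∈ (chart m c).source) :
    (chartForm c η (chart m c y)).compContinuousLinearMap (chartDiff c y) = η y := by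
  obtain ⟨u, hu, rfl⟩ : ∃ u ∈ (chart m c).target, (chart m c).symm u = y :=
    ⟨_, (chart m c).map_source hy, (chart m c).left_inv hy⟩
  rw [(chart m c).right_inv hu]
  ext v
  change η _ (fun i => (chartFrame c u).comp (chartDiff c _) (v i)) = η _ v
  rw [chartFrame_comp_chartDiff c hu]
  rfl

theorem eq_zero_of_chartForm_eq_zero {η : FormField m p M} {c y : M}
    (hy : y ∈ (chart m c).source) (h : chartForm c η (chart m c y) = 0) : η y = 0 := by
  rw [← chartForm_comp_chartDiff η c hy, h]
  rfl

theorem contDiffAt_coordChange {x c : M} {u : Model m} (hu : u ∈ (chart m c).target)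
    (hx : (chart m c).symm u ∈ (chart m x).source) :
    ContDiffAt ℝ ((⊤ : ℕ∞) : WithTop ℕ∞) (chart m x ∘ (chart m c).symm) u := by
  have := contDiffWithinAt_ext_coord_change (I := 𝓘(ℝ, Model m))
    (n := ((⊤ : ℕ∞) : WithTop ℕ∞)) x c (y := u) ⟨hu, hx⟩
  rwa [ModelWithCorners.range_eq_univ, contDiffWithinAt_univ] at this

theorem fderiv_coordChange {x c : M} {u : Model m} (hu : u ∈ (chart m c).target)
    (hx : (chart m c).symm u ∈ (chart m x).source) :
    fderiv ℝ (chart m x ∘ (chart m c).symm) u =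
      (chartDiff x ((chart m c).symm u)).comp (chartFrame c u) := by
  have h1 : MDifferentiableAt 𝓘(ℝ, Model m) 𝓘(ℝ, Model m) (chart m c).symm u := by
    have := mdifferentiableWithinAt_extChartAt_symm (I := 𝓘(ℝ, Model m)) hu
    rwa [ModelWithCorners.range_eq_univ, mdifferentiableWithinAt_univ] at this
  have h2 : MDifferentiableAt 𝓘(ℝ, Model m) 𝓘(ℝ, Model m) (chart m x) ((chart m c).symm u) :=
    mdifferentiableAt_extChartAt (by rwa [← extChartAt_source 𝓘(ℝ, Model m)])
  rw [← mfderiv_eq_fderiv]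
  exact mfderiv_comp u h2 h1

theorem chartForm_eq_pullback (η : FormField m p M) {x c : M} {u : Model m}
    (hu : u ∈ (chart m c).target) (hx : (chart m c).symm u ∈ (chart m x).source) :
    chartForm c η u = (chartForm x η ((chart m x ∘ (chart m c).symm) u)).compContinuousLinearMap
      (fderiv ℝ (chart m x ∘ (chart m c).symm) u) := by
  rw [fderiv_coordChange hu hx, chartForm, ← chartForm_comp_chartDiff η x hx]
  rfl

/-- The exterior derivative is computed in any chart by the exterior derivative on `ℝᵐ`. -/
theorem chartForm_extD {η : FormField m p M} (h : IsSmoothForm η) (c : M) {u : Model m}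
    (hu : u ∈ (chart m c).target) : chartForm c (extD η) u = extDeriv (chartForm c η) u := by
  set y := (chart m c).symm u with hy
  have hyx : y ∈ (chart m y).source := mem_extChartAt_source y
  -- `extD` at `y` is computed in the chart around `y`. Near `u` the two chart expressions differ by
  -- pullback along the transition map, and `d` commutes with pullbacks.
  have hev : chartForm c η =ᶠ[nhds u] fun w =>
      (chartForm y η ((chart m y ∘ (chart m c).symm) w)).compContinuousLinearMap
        (fderiv ℝ (chart m y ∘ (chart m c).symm) w) := by
    have h1 : ∀ᶠ w in nhds u, w ∈ (chart m c).target := (isOpen_chart_target c).mem_nhds hu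
    have h2 : ∀ᶠ w in nhds u, (chart m c).symm w ∈ (chart m y).source :=
      (continuousAt_extChartAt_symm'' hu).eventually
        ((isOpen_extChartAt_source y).mem_nhds hyx)
    filter_upwards [h1, h2] with w hw1 hw2
    exact chartForm_eq_pullback η hw1 hw2
  have hsmooth : minSmoothness ℝ 2 ≤ ((⊤ : ℕ∞) : WithTop ℕ∞) := by
    rw [minSmoothness_of_isRCLikeNormedField]
    exact WithTop.coe_le_coe.2 (le_top : (2 : ℕ∞) ≤ ⊤)
  have hd : DifferentiableAt ℝ (chartForm y η) ((chart m y ∘ (chart m c).symm) u) :=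
    h.differentiableAt y ((chart m y).map_source hyx)
  rw [hev.extDeriv_eq, extDeriv_pullback hd (contDiffAt_coordChange hu hyx) hsmooth,
    fderiv_coordChange hu hyx]
  rfl

theorem IsSmoothForm.extD {η : FormField m p M} (h : IsSmoothForm η) :
    IsSmoothForm (extD η) := fun c => by
  refine ContDiffOn.congr ?_ fun u hu => chartForm_extD h c hu
  exact (ContinuousAlternatingMap.alternatizeUncurryFinCLM ℝ (Model m) ℝ).contDiff.comp_contDiffOn
    ((h c).fderiv_of_isOpen (isOpen_chart_target c)
      (m := ((⊤ : ℕ∞) : WithTop ℕ∞)) le_rfl)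

end Charts

/-! ### The Gram matrix of an almost Hermitian metric -/

section Gram

variable {m : ℕ} {M : Type*} [TopologicalSpace M] [ChartedSpace (Model m) M]

theorem update_vec_zero {α : Type*} (a b c : α) : Function.update ![a, b] 0 c = ![c, b] := by
  ext k : 1
  fin_cases k <;> rfl

theorem update_vec_one {α : Type*} (a b c : α) : Function.update ![a, b] 1 c = ![a, c] := by
  ext k : 1
  fin_cases k <;> rfl

/-- `ω(v, Jw) = ω(Jv, JJw) = -ω(Jv, w) = ω(w, Jv)`. -/
theorem metric_comm {ω : FormField m 2 M} {J : EndoField m M} (h : IsCompatiblePair ω J) (x : M)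
    (v w : Tan m x) : metric ω J x v w = metric ω J x w v := by
  have hswap : ∀ a b : Tan m x, ω x ![a, b] = -ω x ![b, a] := fun a b => by
    have := (ω x).map_swap ![b, a] (i := 0) (j := 1) (by decide)
    refine Eq.trans (congrArg (ω x) ?_) this
    ext k : 1
    fin_cases k <;> rfl
  change ω x ![v, J x w] = ω x ![w, J x v]
  rw [← h.invariant x v (J x w), h.sq_eq_neg, hswap]
  have := (ω x).map_update_smul ![w, J x v] 0 (-1) w
  simp only [neg_smul, one_smul, update_vec_zero] at this
  rw [this, neg_neg]

/-- The almost Hermitian metric as a bilinear form. -/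
noncomputable def metricBilin (ω : FormField m 2 M) (J : EndoField m M) (x : M) :
    LinearMap.BilinForm ℝ (Tan m x) :=
  LinearMap.mk₂ ℝ (metric ω J x)
    (fun u v w => by
      have := (ω x).map_update_add ![u, J x w] 0 u v
      simpa only [metric, update_vec_zero, map_add, map_smul, smul_eq_mul] using this)
    (fun r u w => by
      have := (ω x).map_update_smul ![u, J x w] 0 r u
      simpa only [metric, update_vec_zero, map_add, map_smul, smul_eq_mul] using this)
    (fun u v w => by
      have := (ω x).map_update_add ![u, J x v] 1 (J x v) (J x w)
      simpa only [metric, update_vec_one, map_add, map_smul, smul_eq_mul] using this)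
    (fun r u w => by
      have := (ω x).map_update_smul ![u, J x w] 1 r (J x w)
      simpa only [metric, update_vec_one, map_add, map_smul, smul_eq_mul] using this)

variable [IsManifold 𝓘(ℝ, Model m) ((⊤ : ℕ∞) : WithTop ℕ∞) M]

/-- Inserting `Dφ⁻¹ ∘ Dφ = id` in front of `J` expresses `g_{ij}` through the chart expressions of
`ω` and `J`, which are the objects assumed smooth. -/
theorem chartGram_metric (ω : FormField m 2 M) (J : EndoField m M) (c : M) {u : Model m}
    (hu : u ∈ (chart m c).target) (i j : Fin m) :
    chartGram c (metric ω J) u i j =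
      chartForm c ω u ![stdVec i, chartEndo c J u (stdVec j)] := by
  have h := DFunLike.congr_fun (chartFrame_comp_chartDiff c hu)
    (J ((chart m c).symm u) (chartFrame c u (stdVec j)))
  change ω _ _ = ω _ _
  congr 1
  ext k : 1
  fin_cases k
  · rfl
  · exact h.symm

/-- This is the Gram matrix of the metric pulled back by the chart frame, which is injective because
the differential of the chart is a left inverse. -/
theorem chartGram_posDef {ω : FormField m 2 M} {J : EndoField m M} (h : IsCompatiblePair ω J)
    (c : M) {u : Model m} (hu : u ∈ (chart m c).target) :
    (chartGram c (metric ω J) u).PosDef := by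
  set x := (chart m c).symm u
  let B : LinearMap.BilinForm ℝ (Model m) :=
    (metricBilin ω J x).compl₁₂ (chartFrame c u).toLinearMap (chartFrame c u).toLinearMap
  have hB : B.IsSymm := ⟨fun v w => metric_comm h x _ _⟩
  have hmat : chartGram c (metric ω J) u =
      B.toMatrix (EuclideanSpace.basisFun (Fin m) ℝ).toBasis := by
    ext i j
    simp only [LinearMap.BilinForm.toMatrix_apply, OrthonormalBasis.coe_toBasis,
      EuclideanSpace.basisFun_apply]
    rfl
  rw [hmat, ← LinearMap.BilinForm.posDef_toQuadraticMap_iff_matrix _ _ hB]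
  intro v hv
  refine h.pos x (chartFrame c u v) fun h0 => hv ?_
  have := DFunLike.congr_fun (chartDiff_comp_chartFrame c hu) v
  rw [ContinuousLinearMap.comp_apply, h0, map_zero] at this
  exact this.symm

theorem contDiffOn_chartGram {S : Set ℝ} {ω : ℝ → FormField m 2 M} {J : ℝ → EndoField m M}
    (hω : IsSmoothFormFamily S ω) (hJ : IsSmoothEndoFamily S J) (c : M) (i j : Fin m) :
    ContDiffOn ℝ ((⊤ : ℕ∞) : WithTop ℕ∞)
      (fun q : ℝ × Model m => chartGram c (metric (ω q.1) (J q.1)) q.2 i j)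
      (S ×ˢ (chart m c).target) := by
  refine ContDiffOn.congr ?_ fun q hq => chartGram_metric _ _ c hq.2 i j
  refine contDiffOn_form_apply (hω c) fun k => ?_
  fin_cases k
  · exact contDiffOn_const
  · exact (hJ c).clm_apply contDiffOn_const

end Gram

/-! ### Integrals depending on a parameter -/

section Integrals

variable {E : Type*} [NormedAddCommGroup E] [MeasurableSpace E] [BorelSpace E]
  {μ : Measure E} [IsFiniteMeasureOnCompacts μ] {V K : Set E}

theorem integrableOn_of_isCompact_support (hV : IsOpen V) (hK : IsCompact K) (hKV : K ⊆ V)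
    {f : E → ℝ} (hf : ContinuousOn f V) (h0 : ∀ u ∈ V, u ∉ K → f u = 0) :
    IntegrableOn f V μ :=
  ((hf.mono hKV).integrableOn_compact hK).of_forall_sdiff_eq_zero hV.measurableSet
    fun u hu => h0 u hu.1 hu.2

/-- Dominated convergence. Passing from `V` to `K` makes a constant bound integrable. -/
theorem continuousOn_setIntegral_of_isCompact_support {S : Set ℝ} (hS : IsCompact S)
    (hV : IsOpen V) (hK : IsCompact K) (hKV : K ⊆ V) {f : ℝ × E → ℝ}
    (hf : ContinuousOn f (S ×ˢ V)) (h0 : ∀ t, ∀ u ∈ V, u ∉ K → f (t, u) = 0) :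
    ContinuousOn (fun t => ∫ u in V, f (t, u) ∂μ) S := by
  have heq : ∀ t, ∫ u in V, f (t, u) ∂μ = ∫ u in K, f (t, u) ∂μ := fun t =>
    setIntegral_eq_of_subset_of_forall_sdiff_eq_zero hV.measurableSet hKV
      fun u hu => h0 t u hu.1 hu.2
  simp only [heq]
  have hfK : ContinuousOn f (S ×ˢ K) := hf.mono (prod_mono_right hKV)
  obtain ⟨C, hC⟩ := (hS.prod hK).exists_bound_of_continuousOn hfK
  refine continuousOn_of_dominated (bound := fun _ => C) ?_ ?_ ?_ ?_
  · exact fun t ht => (hfK.comp (by fun_prop) fun u hu => ⟨ht, hu⟩).aestronglyMeasurable_of_isCompact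
      hK hK.measurableSet
  · exact fun t ht => ae_restrict_of_forall_mem hK.measurableSet fun u hu => hC (t, u) ⟨ht, hu⟩
  · exact integrableOn_const hK.measure_ne_top
  · exact ae_restrict_of_forall_mem hK.measurableSet fun u hu =>
      hfK.comp (by fun_prop) fun t ht => ⟨ht, hu⟩

variable [NormedSpace ℝ E]

theorem hasDerivAt_setIntegral_of_isCompact_support {U : Set ℝ} (hU : IsOpen U)
    (hV : IsOpen V) (hK : IsCompact K) (hKV : K ⊆ V) {f : ℝ × E → ℝ}
    (hf : ContDiffOn ℝ 1 f (U ×ˢ V)) (h0 : ∀ t, ∀ u ∈ V, u ∉ K → f (t, u) = 0)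
    {t : ℝ} (ht : t ∈ U) :
    IntegrableOn (fun u => deriv (fun s => f (s, u)) t) V μ ∧
    HasDerivAt (fun s => ∫ u in V, f (s, u) ∂μ)
      (∫ u in V, deriv (fun s => f (s, u)) t ∂μ) t := by
  have heq : ∀ t, ∫ u in V, f (t, u) ∂μ = ∫ u in K, f (t, u) ∂μ := fun t =>
    setIntegral_eq_of_subset_of_forall_sdiff_eq_zero hV.measurableSet hKV
      fun u hu => h0 t u hu.1 hu.2
  have h0' : ∀ u ∈ V \ K, deriv (fun s => f (s, u)) t = 0 := fun u hu => by
    simp only [h0 _ u hu.1 hu.2, deriv_const]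
  have heq' : ∫ u in V, deriv (fun s => f (s, u)) t ∂μ =
      ∫ u in K, deriv (fun s => f (s, u)) t ∂μ :=
    setIntegral_eq_of_subset_of_forall_sdiff_eq_zero hV.measurableSet hKV h0'
  have hd : ∀ s ∈ U, ∀ u ∈ V, HasDerivAt (fun s => f (s, u)) (fderiv ℝ f (s, u) (1, 0)) s :=
    fun s hs u hu => by
      have h1 : HasFDerivAt f (fderiv ℝ f (s, u)) (s, u) :=
        ((hf.contDiffAt ((hU.prod hV).mem_nhds ⟨hs, hu⟩)).differentiableAt
          one_ne_zero).hasFDerivAt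
      exact h1.comp_hasDerivAt s ((hasDerivAt_id s).prodMk (hasDerivAt_const s u))
  have hf' : ContinuousOn (fun q : ℝ × E => deriv (fun s => f (s, q.2)) q.1) (U ×ˢ V) := by
    have h1 : ContinuousOn (fun q => fderiv ℝ f q (1, 0)) (U ×ˢ V) :=
      (hf.continuousOn_fderiv_of_isOpen (hU.prod hV) le_rfl).clm_apply continuousOn_const
    exact h1.congr fun q hq => (hd q.1 hq.1 q.2 hq.2).deriv
  -- A compact neighbourhood of `t` inside `U`: on its product with `K` the time derivative is
  -- bounded, which gives the dominating constant.
  obtain ⟨ε, hε, hεU⟩ := Metric.nhds_basis_closedBall.mem_iff.1 (hU.mem_nhds ht)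
  have hB : IsCompact (Metric.closedBall t ε) := isCompact_closedBall t ε
  obtain ⟨C, hC⟩ := (hB.prod hK).exists_bound_of_continuousOn (hf'.mono (prod_mono hεU hKV))
  have hmeas : ∀ s ∈ U, ContinuousOn (fun u => f (s, u)) K := fun s hs =>
    hf.continuousOn.comp (by fun_prop) fun u hu => ⟨hs, hKV hu⟩
  have hmeas' : ContinuousOn (fun u => deriv (fun s => f (s, u)) t) K :=
    hf'.comp (f := fun u => (t, u)) (by fun_prop) fun u hu => ⟨ht, hKV hu⟩
  simp only [heq, heq']
  refine ⟨(hmeas'.integrableOn_compact hK).of_forall_sdiff_eq_zero hV.measurableSet h0', ?_⟩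
  refine (hasDerivAt_integral_of_dominated_loc_of_deriv_le (bound := fun _ => C)
    (F' := fun s u => deriv (fun s => f (s, u)) s)
    (Metric.closedBall_mem_nhds t hε) ?_ ((hmeas t ht).integrableOn_compact hK)
    (hmeas'.aestronglyMeasurable_of_isCompact hK hK.measurableSet) ?_
    (integrableOn_const hK.measure_ne_top) ?_).2
  · filter_upwards [hU.mem_nhds ht] with s hs
    exact (hmeas s hs).aestronglyMeasurable_of_isCompact hK hK.measurableSet
  · exact ae_restrict_of_forall_mem hK.measurableSet fun u hu s hs => hC (s, u) ⟨hs, hu⟩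
  · exact ae_restrict_of_forall_mem hK.measurableSet fun u hu s hs =>
      (hd s (hεU hs) u (hKV hu)).differentiableAt.hasDerivAt

end Integrals

/-! ### Partial derivatives -/

section PartialDerivatives

variable {E F : Type*} [NormedAddCommGroup E] [NormedSpace ℝ E] [NormedAddCommGroup F]
  [NormedSpace ℝ F]

/-- The spatial derivative is the total derivative within `S × V` restricted to the second factor.
Derivatives within the set give smoothness up to the endpoints of `S`. -/
theorem contDiffOn_fderiv_right {S : Set ℝ} {V : Set E} (hS : UniqueDiffOn ℝ S) (hV : IsOpen V)
    {f : ℝ × E → F} (hf : ContDiffOn ℝ ((⊤ : ℕ∞) : WithTop ℕ∞) f (S ×ˢ V)) :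
    ContDiffOn ℝ ((⊤ : ℕ∞) : WithTop ℕ∞)
      (fun q : ℝ × E => fderiv ℝ (fun w => f (q.1, w)) q.2) (S ×ˢ V) := by
  have h1 : ContDiffOn ℝ ((⊤ : ℕ∞) : WithTop ℕ∞) (fun q =>
      (fderivWithin ℝ f (S ×ˢ V) q).comp (ContinuousLinearMap.inr ℝ ℝ E)) (S ×ˢ V) :=
    (hf.fderivWithin (m := ((⊤ : ℕ∞) : WithTop ℕ∞)) (hS.prod hV.uniqueDiffOn)
      le_rfl).clm_comp contDiffOn_const
  refine h1.congr fun q hq => ?_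
  have h2 : HasFDerivWithinAt f (fderivWithin ℝ f (S ×ˢ V) q) (S ×ˢ V) (q.1, q.2) :=
    ((hf q hq).differentiableWithinAt (by simp)).hasFDerivWithinAt
  have h3 := h2.comp q.2 (hasFDerivAt_prodMk_right q.1 q.2).hasFDerivWithinAt
    (fun w hw => ⟨hq.1, hw⟩ : MapsTo (fun w => (q.1, w)) V (S ×ˢ V))
  exact (h3.hasFDerivAt (hV.mem_nhds hq.2)).fderiv

/-- Symmetry of the second derivative of `f` at `(t, u)`: `∂_t D_u f = D_u ∂_t f`. The time
derivative `g` is needed only at the single time `t`. -/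
theorem hasDerivAt_fderiv_right {f : ℝ × E → F} {t : ℝ} {u : E} (hf : ContDiffAt ℝ 2 f (t, u))
    {g : E → F} (hg : ∀ᶠ w in nhds u, HasDerivAt (fun s => f (s, w)) (g w) t) :
    HasDerivAt (fun s => fderiv ℝ (fun w => f (s, w)) u) (fderiv ℝ g u) t := by
  have hdiff : ∀ᶠ q in nhds (t, u), HasFDerivAt f (fderiv ℝ f q) q :=
    (hf.eventually (by simp)).mono fun q hq => (hq.differentiableAt (by simp)).hasFDerivAt
  have hdiff2 : HasFDerivAt (fderiv ℝ f) (fderiv ℝ (fderiv ℝ f) (t, u)) (t, u) :=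
    ((hf.fderiv_right (m := 1) (by norm_num)).differentiableAt (by simp)).hasFDerivAt
  have hsymm : IsSymmSndFDerivAt ℝ f (t, u) := hf.isSymmSndFDerivAt (by simp)
  have h1 : (fun s => fderiv ℝ (fun w => f (s, w)) u) =ᶠ[nhds t]
      fun s => (fderiv ℝ f (s, u)).comp (ContinuousLinearMap.inr ℝ ℝ E) := by
    have : Filter.Tendsto (fun s : ℝ => (s, u)) (nhds t) (nhds (t, u)) :=
      (Continuous.prodMk_left u).tendsto t
    filter_upwards [this.eventually hdiff] with s hs
    exact (HasFDerivAt.comp u hs (hasFDerivAt_prodMk_right s u)).fderiv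
  have h2 : g =ᶠ[nhds u] fun w => fderiv ℝ f (t, w) (1, 0) := by
    have : Filter.Tendsto (fun w : E => (t, w)) (nhds u) (nhds (t, u)) :=
      (Continuous.prodMk_right t).tendsto u
    filter_upwards [this.eventually hdiff, hg] with w hw hgw
    exact hgw.unique (hw.comp_hasDerivAt t ((hasDerivAt_id t).prodMk (hasDerivAt_const t w)))
  have h3 : HasFDerivAt (fun w => fderiv ℝ f (t, w) (1, 0))
      (((ContinuousLinearMap.apply ℝ F ((1, 0) : ℝ × E)).comp
        (fderiv ℝ (fderiv ℝ f) (t, u))).comp (ContinuousLinearMap.inr ℝ ℝ E)) u :=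
    ((ContinuousLinearMap.apply ℝ F ((1, 0) : ℝ × E)).hasFDerivAt.comp (t, u) hdiff2).comp u
      (hasFDerivAt_prodMk_right t u)
  have h4 : HasDerivAt (fun s => (fderiv ℝ f (s, u)).comp (ContinuousLinearMap.inr ℝ ℝ E))
      ((fderiv ℝ (fderiv ℝ f) (t, u) (1, 0)).comp (ContinuousLinearMap.inr ℝ ℝ E)) t := by
    have h5 := hdiff2.comp_hasDerivAt t ((hasDerivAt_id t).prodMk (hasDerivAt_const t u))
    simpa using HasDerivAt.clm_comp h5 (hasDerivAt_const t (ContinuousLinearMap.inr ℝ ℝ E))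
  rw [h2.fderiv_eq, h3.fderiv]
  refine (h4.congr_of_eventuallyEq h1).congr_deriv ?_
  ext v
  exact hsymm.eq (1, 0) (0, v)

end PartialDerivatives

/-! ### The `L²` inner product -/

section L2

open Matrix

theorem contDiffOn_dotProduct_mulVec {E ι : Type*} [NormedAddCommGroup E] [NormedSpace ℝ E]
    [Fintype ι] {k : WithTop ℕ∞} {s : Set E} {v w : E → ι → ℝ} {W : E → Matrix ι ι ℝ}
    (hv : ∀ a, ContDiffOn ℝ k (fun x => v x a) s) (hw : ∀ a, ContDiffOn ℝ k (fun x => w x a) s)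
    (hW : ∀ a b, ContDiffOn ℝ k (fun x => W x a b) s) :
    ContDiffOn ℝ k (fun x => v x ⬝ᵥ W x *ᵥ w x) s := by
  simp only [dotProduct, Matrix.mulVec]
  exact ContDiffOn.sum fun a _ => (hv a).mul (ContDiffOn.sum fun b _ => (hW a b).mul (hw b))

variable {m p : ℕ} {M : Type*} [TopologicalSpace M] [ChartedSpace (Model m) M]

/-- The integrand of `l2Inner` in the chart around `c`, without the cutoff function. -/
noncomputable def innerDensity (c : M) (g : BilinField m M) (α β : FormField m p M)
    (u : Model m) : ℝ :=
  components (chartForm c α u) ⬝ᵥ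
    densityGram p (chartGram c g u) *ᵥ components (chartForm c β u)

theorem innerDensity_self_nonneg {c : M} {g : BilinField m M} {u : Model m}
    (hg : (chartGram c g u).PosDef) (α : FormField m p M) : 0 ≤ innerDensity c g α α u :=
  dotProduct_densityGram_nonneg hg _

theorem chartForm_eq_zero_of_innerDensity {c : M} {g : BilinField m M} {u : Model m}
    (hg : (chartGram c g u).PosDef) {α : FormField m p M} (h : innerDensity c g α α u = 0) :
    chartForm c α u = 0 := by
  refine components_eq_zero ?_
  by_contra hne
  have := (densityGram_posDef (p := p) hg).dotProduct_mulVec_pos hne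
  simp only [star_trivial] at this
  exact this.ne' h

theorem contDiffOn_innerDensity {g : BilinField m M} {α β : FormField m p M}
    (hα : IsSmoothForm α) (hβ : IsSmoothForm β) (c : M)
    (hgs : ∀ i j, ContDiffOn ℝ ((⊤ : ℕ∞) : WithTop ℕ∞) (fun u => chartGram c g u i j)
      (chart m c).target)
    (hg : ∀ u ∈ (chart m c).target, (chartGram c g u).PosDef) :
    ContDiffOn ℝ ((⊤ : ℕ∞) : WithTop ℕ∞) (innerDensity c g α β) (chart m c).target := by
  exact contDiffOn_dotProduct_mulVec (contDiffOn_components (hα c)) (contDiffOn_components (hβ c))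
    (contDiffOn_densityGram hgs hg)

variable [T2Space M] [CompactSpace M] [IsManifold 𝓘(ℝ, Model m) ((⊤ : ℕ∞) : WithTop ℕ∞) M]

/-- The expression in the chart around `c` of the cutoff function belonging to this chart. -/
noncomputable def cutoff (c : M) (u : Model m) : ℝ :=
  chartPartition m M c ((chart m c).symm u)

/-- The compact set in the chart around `c` that contains the support of the cutoff function. -/
def cutoffSupport (m : ℕ) {M : Type*} [TopologicalSpace M] [T2Space M] [CompactSpace M]
    [ChartedSpace (Model m) M] [IsManifold 𝓘(ℝ, Model m) ((⊤ : ℕ∞) : WithTop ℕ∞) M] (c : M) :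
    Set (Model m) :=
  chart m c '' tsupport (chartPartition m M c)

theorem tsupport_chartPartition_subset (c : M) :
    tsupport (chartPartition m M c) ⊆ (chart m c).source := by
  rw [extChartAt_source]
  exact Classical.choose_spec
    (SmoothPartitionOfUnity.exists_isSubordinate_chartAt_source 𝓘(ℝ, Model m) M) c

theorem isCompact_cutoffSupport (c : M) : IsCompact (cutoffSupport m c) :=
  (isClosed_tsupport _).isCompact.image_of_continuousOn
    ((continuousOn_extChartAt c).mono (tsupport_chartPartition_subset c))

theorem cutoffSupport_subset (c : M) : cutoffSupport m c ⊆ (chart m c).target := by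
  rintro _ ⟨x, hx, rfl⟩
  exact (chart m c).map_source (tsupport_chartPartition_subset c hx)

theorem cutoff_nonneg (c : M) (u : Model m) : 0 ≤ cutoff c u :=
  (chartPartition m M).nonneg c _

theorem cutoff_eq_zero (c : M) {u : Model m} (hu : u ∈ (chart m c).target)
    (h : u ∉ cutoffSupport m c) : cutoff c u = 0 := by
  by_contra hne
  exact h ⟨_, subset_tsupport _ hne, (chart m c).right_inv hu⟩

theorem contDiffOn_cutoff (c : M) :
    ContDiffOn ℝ ((⊤ : ℕ∞) : WithTop ℕ∞) (cutoff (m := m) c) (chart m c).target := by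
  rw [← contMDiffOn_iff_contDiffOn]
  exact (chartPartition m M c).contMDiff.comp_contMDiffOn (contMDiffOn_extChartAt_symm c)

variable (m M) in
-- A locally finite partition of unity on a compact space has finitely many nonzero members. The
-- index set does not depend on the metric or the forms, so one finite sum serves all times.
theorem exists_l2Inner_eq_sum : ∃ s : Finset M, (∀ c ∉ s, ∀ u : Model m, cutoff c u = 0) ∧
    ∀ (p : ℕ) (g : BilinField m M)
    (α β : FormField m p M), l2Inner g α β =
      ∑ c ∈ s, ∫ u in (chart m c).target, cutoff c u * innerDensity c g α β u := by
  have hfin : (Function.support fun c => (chartPartition m M c : M → ℝ)).Finite := by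
    refine ((chartPartition m M).locallyFinite.finite_nonempty_of_compact).subset fun c hc => ?_
    exact Function.support_nonempty_iff.2 hc
  have hzero : ∀ c ∉ hfin.toFinset, ∀ u : Model m, cutoff c u = 0 := fun c hc u => by
    have h0 : (chartPartition m M c : M → ℝ) = 0 := by simpa using hc
    exact congrFun h0 _
  refine ⟨hfin.toFinset, hzero, fun p g α β => ?_⟩
  have heq : l2Inner g α β =
      ∑ᶠ c : M, ∫ u in (chart m c).target, cutoff c u * innerDensity c g α β u := by
    refine finsum_congr fun c => integral_congr_ae (Filter.Eventually.of_forall fun u => ?_)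
    change cutoff c u * _ * _ = _
    rw [mul_assoc, formInner_mul_sqrt_det]
    rfl
  rw [heq]
  refine finsum_eq_sum_of_support_subset _ fun c hc => ?_
  by_contra hcs
  exact hc (by simp [hzero c hcs])

theorem integrableOn_innerDensity {g : BilinField m M} {α β : FormField m p M}
    (hα : IsSmoothForm α) (hβ : IsSmoothForm β) (c : M)
    (hgs : ∀ i j, ContDiffOn ℝ ((⊤ : ℕ∞) : WithTop ℕ∞) (fun u => chartGram c g u i j)
      (chart m c).target)
    (hg : ∀ u ∈ (chart m c).target, (chartGram c g u).PosDef) :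
    IntegrableOn (fun u => cutoff c u * innerDensity c g α β u) (chart m c).target :=
  integrableOn_of_isCompact_support (isOpen_chart_target c) (isCompact_cutoffSupport c)
    (cutoffSupport_subset c)
    ((contDiffOn_cutoff c).continuousOn.mul (contDiffOn_innerDensity hα hβ c hgs hg).continuousOn)
    fun u hu h => by rw [cutoff_eq_zero c hu h, zero_mul]

theorem setIntegral_innerDensity_self_nonneg {c : M} {g : BilinField m M}
    (hg : ∀ u ∈ (chart m c).target, (chartGram c g u).PosDef) (α : FormField m p M) :
    0 ≤ ∫ u in (chart m c).target, cutoff c u * innerDensity c g α α u :=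
  setIntegral_nonneg (isOpen_chart_target c).measurableSet fun u hu =>
    mul_nonneg (cutoff_nonneg c u) (innerDensity_self_nonneg (hg u hu) α)

theorem l2Inner_self_nonneg {g : BilinField m M}
    (hg : ∀ c : M, ∀ u ∈ (chart m c).target, (chartGram c g u).PosDef) (α : FormField m p M) :
    0 ≤ l2Inner g α α := by
  obtain ⟨s, -, hs⟩ := exists_l2Inner_eq_sum m M
  rw [hs]
  exact Finset.sum_nonneg fun c _ => setIntegral_innerDensity_self_nonneg (hg c) α

theorem exists_cutoff_pos (x : M) : ∃ c : M, x ∈ (chart m c).source ∧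
    0 < cutoff c (chart m c x) := by
  obtain ⟨c, hc⟩ := (chartPartition m M).exists_pos_of_mem (mem_univ x)
  have hx : x ∈ (chart m c).source :=
    tsupport_chartPartition_subset c (subset_tsupport _ hc.ne')
  exact ⟨c, hx, by rwa [cutoff, (chart m c).left_inv hx]⟩

/-- A vanishing sum of nonnegative integrals has vanishing terms. At each point some cutoff is
positive, so the definite inner product there must vanish. -/
theorem eq_zero_of_l2Inner_self {g : BilinField m M} {α : FormField m p M}
    (hα : IsSmoothForm α)
    (hgs : ∀ c : M, ∀ i j, ContDiffOn ℝ ((⊤ : ℕ∞) : WithTop ℕ∞) (fun u => chartGram c g u i j)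
      (chart m c).target)
    (hg : ∀ c : M, ∀ u ∈ (chart m c).target, (chartGram c g u).PosDef)
    (h : l2Inner g α α = 0) : α = 0 := by
  obtain ⟨s, hs0, hs⟩ := exists_l2Inner_eq_sum m M
  rw [hs, Finset.sum_eq_zero_iff_of_nonneg fun c _ =>
    setIntegral_innerDensity_self_nonneg (hg c) α] at h
  funext x
  obtain ⟨c, hx, hpos⟩ := exists_cutoff_pos (m := m) x
  refine eq_zero_of_chartForm_eq_zero hx ?_
  have hu : chart m c x ∈ (chart m c).target := (chart m c).map_source hx
  refine chartForm_eq_zero_of_innerDensity (hg c _ hu) ?_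
  have hcs : c ∈ s := by
    by_contra hcs
    exact hpos.ne' (hs0 c hcs _)
  have hint := (setIntegral_eq_zero_iff_of_nonneg_ae
    (ae_restrict_of_forall_mem (isOpen_chart_target c).measurableSet fun u hu =>
      mul_nonneg (cutoff_nonneg c u) (innerDensity_self_nonneg (hg c u hu) α))
    (integrableOn_innerDensity hα hα c (hgs c) (hg c))).1 (h c hcs)
  -- Continuity on an open set upgrades vanishing almost everywhere to vanishing everywhere.
  have heq := Measure.eqOn_open_of_ae_eq hint (isOpen_chart_target c)
    ((contDiffOn_cutoff c).continuousOn.mul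
      (contDiffOn_innerDensity hα hα c (hgs c) (hg c)).continuousOn) continuousOn_const hu
  exact (mul_eq_zero.1 heq).resolve_left hpos.ne'

end L2

/-! ### The evolution of the exterior derivative -/

section Evolution

open Matrix

/-- Product rule; symmetry of `W t` merges the two terms in which a vector is differentiated. -/
theorem hasDerivAt_dotProduct_mulVec {ι : Type*} [Fintype ι] {v : ℝ → ι → ℝ} {v' : ι → ℝ}
    {W : ℝ → Matrix ι ι ℝ} {W' : Matrix ι ι ℝ} {t : ℝ}
    (hv : ∀ a, HasDerivAt (fun s => v s a) (v' a) t)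
    (hW : ∀ a b, HasDerivAt (fun s => W s a b) (W' a b) t) (hsymm : (W t).IsHermitian) :
    HasDerivAt (fun s => v s ⬝ᵥ W s *ᵥ v s) (2 * (v t ⬝ᵥ W t *ᵥ v') + v t ⬝ᵥ W' *ᵥ v t) t := by
  have h1 : HasDerivAt (fun s => v s ⬝ᵥ W s *ᵥ v s)
      (∑ a, (v' a * ∑ b, W t a b * v t b + v t a * ∑ b, (W' a b * v t b + W t a b * v' b))) t := by
    simp only [dotProduct, Matrix.mulVec]
    exact HasDerivAt.fun_sum fun a _ =>
      (hv a).mul (HasDerivAt.fun_sum fun b _ => (hW a b).mul (hv b))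
  have h2 : v' ⬝ᵥ W t *ᵥ v t = v t ⬝ᵥ W t *ᵥ v' := by
    rw [dotProduct_mulVec, ← mulVec_transpose, dotProduct_comm]
    rw [Matrix.isHermitian_iff_isSymm.1 hsymm]
  refine h1.congr_deriv ?_
  calc _ = v' ⬝ᵥ W t *ᵥ v t + v t ⬝ᵥ W' *ᵥ v t + v t ⬝ᵥ W t *ᵥ v' := by
        simp only [dotProduct, Matrix.mulVec, ← Finset.sum_add_distrib]
        refine Finset.sum_congr rfl fun a _ => ?_
        rw [Finset.sum_add_distrib]
        ring
    _ = _ := by rw [h2]; ring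

variable {m p : ℕ} {M : Type*} [TopologicalSpace M] [ChartedSpace (Model m) M]

/-- Joint smoothness supplies a derivative in the normed space of covectors; the given derivatives
of the evaluations then identify it. -/
theorem hasDerivAt_chartForm {S : Set ℝ} {ω : ℝ → FormField m p M} (hω : IsSmoothFormFamily S ω)
    {t : ℝ} (ht : S ∈ nhds t) {η : FormField m p M}
    (hη : ∀ (x : M) (v : Fin p → Tan m x), HasDerivAt (fun s => ω s x v) (η x v) t)
    (c : M) {u : Model m} (hu : u ∈ (chart m c).target) :
    HasDerivAt (fun s => chartForm c (ω s) u) (chartForm c η u) t := by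
  have h1 : DifferentiableAt ℝ (fun q : ℝ × Model m => chartForm c (ω q.1) q.2) (t, u) :=
    ((hω c).contDiffAt (prod_mem_nhds ht
      ((isOpen_chart_target c).mem_nhds hu))).differentiableAt (by simp)
  have h2 : HasDerivAt (fun s => chartForm c (ω s) u) _ t :=
    HasFDerivAt.comp_hasDerivAt (l := fun q : ℝ × Model m => chartForm c (ω q.1) q.2) t
      h1.hasFDerivAt ((hasDerivAt_id t).prodMk (hasDerivAt_const t u))
  refine h2.congr_deriv ?_
  ext v
  have h3 : HasDerivAt (fun s => chartForm c (ω s) u v) _ t :=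
    (ContinuousAlternatingMap.apply ℝ (Model m) ℝ v).hasFDerivAt.comp_hasDerivAt t h2
  exact h3.unique (hη _ _)

variable [IsManifold 𝓘(ℝ, Model m) ((⊤ : ℕ∞) : WithTop ℕ∞) M]

/-- In a chart, `d` is a fixed linear map applied to the spatial derivative, and the latter commutes
with `∂_t`. -/
theorem hasDerivAt_chartForm_extD {S : Set ℝ} {ω : ℝ → FormField m p M}
    (hω : IsSmoothFormFamily S ω) {t : ℝ} (ht : S ∈ nhds t) {η : FormField m p M}
    (hηs : IsSmoothForm η)
    (hη : ∀ (x : M) (v : Fin p → Tan m x), HasDerivAt (fun s => ω s x v) (η x v) t)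
    (c : M) {u : Model m} (hu : u ∈ (chart m c).target) :
    HasDerivAt (fun s => chartForm c (extD (ω s)) u) (chartForm c (extD η) u) t := by
  have hnhds : S ×ˢ (chart m c).target ∈ nhds (t, u) :=
    prod_mem_nhds ht ((isOpen_chart_target c).mem_nhds hu)
  have h1 : HasDerivAt (fun s => fderiv ℝ (chartForm c (ω s)) u) (fderiv ℝ (chartForm c η) u) t :=
    hasDerivAt_fderiv_right (f := fun q : ℝ × Model m => chartForm c (ω q.1) q.2)
      (((hω c).contDiffAt hnhds).of_le (WithTop.coe_le_coe.2 le_top)) <| by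
        filter_upwards [(isOpen_chart_target c).mem_nhds hu] with w hw
        exact hasDerivAt_chartForm hω ht hη c hw
  have h2 := HasFDerivAt.comp_hasDerivAt (F := Model m →L[ℝ] Model m [⋀^Fin p]→L[ℝ] ℝ) t
    (ContinuousAlternatingMap.alternatizeUncurryFinCLM ℝ (Model m) ℝ).hasFDerivAt h1
  rw [chartForm_extD hηs c hu]
  refine HasDerivAt.congr_of_eventuallyEq h2 ?_
  filter_upwards [ht] with s hs
  exact chartForm_extD (hω.isSmoothForm hs) c hu

theorem contDiffOn_chartForm_extD {S : Set ℝ} (hS : UniqueDiffOn ℝ S) {ω : ℝ → FormField m p M}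
    (hω : IsSmoothFormFamily S ω) : IsSmoothFormFamily S fun t => extD (ω t) := fun c => by
  refine ContDiffOn.congr ?_ fun q hq => chartForm_extD (hω.isSmoothForm hq.1) c hq.2
  exact (ContinuousAlternatingMap.alternatizeUncurryFinCLM ℝ (Model m) ℝ).contDiff.comp_contDiffOn
    (contDiffOn_fderiv_right hS (isOpen_chart_target c) (hω c))

end Evolution

/-! ### Closedness is preserved -/

section Energy

open Matrix

variable {m p : ℕ} {M : Type*} [TopologicalSpace M] [ChartedSpace (Model m) M]

theorem IsSmoothForm.neg {η : FormField m p M} (h : IsSmoothForm η) : IsSmoothForm (-η) :=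
  fun c => (h c).neg

theorem innerDensity_neg_right (c : M) (g : BilinField m M) (α β : FormField m p M)
    (u : Model m) : innerDensity c g α (-β) u = -innerDensity c g α β u := by
  change _ ⬝ᵥ _ *ᵥ components (-chartForm c β u) = _
  rw [components_neg, Matrix.mulVec_neg, dotProduct_neg]
  rfl

theorem innerDensity_zero_left (c : M) (g : BilinField m M) (β : FormField m p M)
    (u : Model m) : innerDensity c g 0 β u = 0 := by
  change components (0 : Model m [⋀^Fin p]→L[ℝ] ℝ) ⬝ᵥ _ *ᵥ _ = _
  rw [components_zero, zero_dotProduct]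

variable [IsManifold 𝓘(ℝ, Model m) ((⊤ : ℕ∞) : WithTop ℕ∞) M]

theorem contDiffOn_innerDensity_family {S : Set ℝ} {ω : ℝ → FormField m 2 M}
    {J : ℝ → EndoField m M} (hω : IsSmoothFormFamily S ω) (hJ : IsSmoothEndoFamily S J)
    (hc : ∀ t ∈ S, IsCompatiblePair (ω t) (J t)) {η : ℝ → FormField m p M}
    (hη : IsSmoothFormFamily S η) (c : M) :
    ContDiffOn ℝ ((⊤ : ℕ∞) : WithTop ℕ∞) (fun q : ℝ × Model m =>
      innerDensity c (metric (ω q.1) (J q.1)) (η q.1) (η q.1) q.2) (S ×ˢ (chart m c).target) :=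
  contDiffOn_dotProduct_mulVec (contDiffOn_components (hη c)) (contDiffOn_components (hη c))
    (contDiffOn_densityGram (contDiffOn_chartGram hω hJ c)
      fun q hq => chartGram_posDef (hc q.1 hq.1) c hq.2)

theorem contDiffOn_chartGram_metric {S : Set ℝ} {ω : ℝ → FormField m 2 M}
    {J : ℝ → EndoField m M} (hω : IsSmoothFormFamily S ω) (hJ : IsSmoothEndoFamily S J)
    {t : ℝ} (ht : t ∈ S) (c : M) (i j : Fin m) :
    ContDiffOn ℝ ((⊤ : ℕ∞) : WithTop ℕ∞) (fun u => chartGram c (metric (ω t) (J t)) u i j)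
      (chart m c).target :=
  (contDiffOn_chartGram hω hJ c i j).comp (contDiff_prodMk_right t).contDiffOn
    fun _ hu => ⟨ht, hu⟩

/-- Differentiating `⟨dω, dω⟩ dv` gives twice the pairing with `d(∂_t ω)`, plus the time derivative
of the Gram matrix evaluated on `dω`. By compactness `C` times the Gram matrix dominates this
derivative, with `C` independent of `t` and `η`. -/
theorem exists_hasDerivAt_innerDensity_le {T : ℝ} (hT : 0 < T) {ω : ℝ → FormField m 2 M}
    {J : ℝ → EndoField m M} (hω : IsSmoothFormFamily (Icc 0 T) ω)
    (hJ : IsSmoothEndoFamily (Icc 0 T) J)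
    (hc : ∀ t ∈ Icc 0 T, IsCompatiblePair (ω t) (J t)) (c : M) {K : Set (Model m)}
    (hK : IsCompact K) (hKc : K ⊆ (chart m c).target) :
    ∃ C : ℝ, ∀ t ∈ Ioo 0 T, ∀ η : FormField m 2 M, IsSmoothForm η →
      (∀ (x : M) (v : Fin 2 → Tan m x), HasDerivAt (fun s => ω s x v) (η x v) t) →
      ∀ u ∈ K, ∃ D : ℝ, HasDerivAt (fun s =>
        innerDensity c (metric (ω s) (J s)) (extD (ω s)) (extD (ω s)) u) D t ∧
        D ≤ 2 * innerDensity c (metric (ω t) (J t)) (extD (ω t)) (extD η) u +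
          C * innerDensity c (metric (ω t) (J t)) (extD (ω t)) (extD (ω t)) u := by
  let W : ℝ × Model m → Matrix (Fin 3 → Fin m) (Fin 3 → Fin m) ℝ := fun q =>
    densityGram 3 (chartGram c (metric (ω q.1) (J q.1)) q.2)
  let V := Icc 0 T ×ˢ (chart m c).target
  have hW : ∀ a b, ContDiffOn ℝ ((⊤ : ℕ∞) : WithTop ℕ∞) (fun q => W q a b) V :=
    contDiffOn_densityGram (contDiffOn_chartGram hω hJ c)
      fun q hq => chartGram_posDef (hc q.1 hq.1) c hq.2
  have hVu : UniqueDiffOn ℝ V := (uniqueDiffOn_Icc hT).prod (isOpen_chart_target c).uniqueDiffOn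
  -- The time derivative of `W`, taken within `V` so that it is continuous up to the endpoints and
  -- hence over the compact set `Icc 0 T × K`.
  let W' : ℝ × Model m → Matrix (Fin 3 → Fin m) (Fin 3 → Fin m) ℝ := fun q =>
    Matrix.of fun a b => fderivWithin ℝ (fun q => W q a b) V q (1, 0)
  have hW' : ∀ a b, ContinuousOn (fun q => W' q a b) V := fun a b =>
    ((hW a b).continuousOn_fderivWithin hVu (by simp)).clm_apply continuousOn_const
  have hKV : Icc 0 T ×ˢ K ⊆ V := prod_mono_right hKc
  obtain ⟨C, hC⟩ := exists_quadraticForm_le (isCompact_Icc.prod hK)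
    (fun a b => (hW a b).continuousOn.mono hKV) (fun a b => (hW' a b).mono hKV)
    (fun q hq => densityGram_posDef (chartGram_posDef (hc q.1 hq.1) c (hKc hq.2)))
  refine ⟨C, fun t ht η hηs hη u hu => ?_⟩
  have htS : Icc 0 T ∈ nhds t := Icc_mem_nhds ht.1 ht.2
  have htm : t ∈ Icc 0 T := Ioo_subset_Icc_self ht
  have huc : u ∈ (chart m c).target := hKc hu
  have hVn : V ∈ nhds (t, u) := prod_mem_nhds htS ((isOpen_chart_target c).mem_nhds huc)
  have hWd : ∀ a b, HasDerivAt (fun s => W (s, u) a b) (W' (t, u) a b) t := fun a b => by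
    have h1 : HasFDerivAt (fun q => W q a b) (fderivWithin ℝ (fun q => W q a b) V (t, u)) (t, u) :=
      (((hW a b) (t, u) ⟨htm, huc⟩).differentiableWithinAt (by simp)).hasFDerivWithinAt.hasFDerivAt
        hVn
    exact h1.comp_hasDerivAt t ((hasDerivAt_id t).prodMk (hasDerivAt_const t u))
  have hv : ∀ a, HasDerivAt (fun s => components (chartForm c (extD (ω s)) u) a)
      (components (chartForm c (extD η) u) a) t := fun a =>
    (ContinuousAlternatingMap.apply ℝ (Model m) ℝ
      fun i => stdVec (a i)).hasFDerivAt.comp_hasDerivAt t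
      (hasDerivAt_chartForm_extD hω htS hηs hη c huc)
  refine ⟨_, hasDerivAt_dotProduct_mulVec hv hWd
    (densityGram_posDef (chartGram_posDef (hc t htm) c huc)).isHermitian, ?_⟩
  exact add_le_add_right (hC (t, u) ⟨htm, hu⟩ _) _

variable [T2Space M] [CompactSpace M]

/-- Along a family of almost Hermitian structures, the energy of `dω` satisfies a differential
inequality. -/
theorem exists_hasDerivAt_energy_le {T : ℝ} (hT : 0 < T) {ω : ℝ → FormField m 2 M}
    {J : ℝ → EndoField m M} (hω : IsSmoothFormFamily (Icc 0 T) ω)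
    (hJ : IsSmoothEndoFamily (Icc 0 T) J)
    (hc : ∀ t ∈ Icc 0 T, IsCompatiblePair (ω t) (J t)) (c : M) :
    ∃ C : ℝ, ∀ t ∈ Ioo 0 T, ∀ η : FormField m 2 M, IsSmoothForm η →
      (∀ (x : M) (v : Fin 2 → Tan m x), HasDerivAt (fun s => ω s x v) (η x v) t) →
      ∃ D : ℝ, HasDerivAt (fun s => ∫ u in (chart m c).target, cutoff c u *
        innerDensity c (metric (ω s) (J s)) (extD (ω s)) (extD (ω s)) u) D t ∧
        D ≤ 2 * (∫ u in (chart m c).target, cutoff c u *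
            innerDensity c (metric (ω t) (J t)) (extD (ω t)) (extD η) u) +
          C * ∫ u in (chart m c).target, cutoff c u *
            innerDensity c (metric (ω t) (J t)) (extD (ω t)) (extD (ω t)) u := by
  obtain ⟨C, hC⟩ := exists_hasDerivAt_innerDensity_le hT hω hJ hc c (isCompact_cutoffSupport c)
    (cutoffSupport_subset c)
  refine ⟨C, fun t ht η hηs hη => ?_⟩
  have htm : t ∈ Icc 0 T := Ioo_subset_Icc_self ht
  have hV := isOpen_chart_target (m := m) c
  let f : ℝ × Model m → ℝ := fun q => cutoff c q.2 *
    innerDensity c (metric (ω q.1) (J q.1)) (extD (ω q.1)) (extD (ω q.1)) q.2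
  have hf : ContDiffOn ℝ 1 f (Ioo 0 T ×ˢ (chart m c).target) := by
    have h1 : ContDiffOn ℝ ((⊤ : ℕ∞) : WithTop ℕ∞) f (Icc 0 T ×ˢ (chart m c).target) :=
      ((contDiffOn_cutoff c).comp contDiff_snd.contDiffOn fun q hq => hq.2).mul
        (contDiffOn_innerDensity_family hω hJ hc
          (contDiffOn_chartForm_extD (uniqueDiffOn_Icc hT) hω) c)
    exact (h1.of_le (by simp)).mono (prod_mono_left Ioo_subset_Icc_self)
  obtain ⟨hint, hder⟩ := hasDerivAt_setIntegral_of_isCompact_support (μ := volume) isOpen_Ioo hV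
    (isCompact_cutoffSupport c) (cutoffSupport_subset c) hf
    (fun s u hu h => by simp only [f, cutoff_eq_zero c hu h, zero_mul]) ht
  refine ⟨_, hder, ?_⟩
  have hgs := contDiffOn_chartGram_metric hω hJ htm c
  have hg : ∀ u ∈ (chart m c).target, (chartGram c (metric (ω t) (J t)) u).PosDef :=
    fun u hu => chartGram_posDef (hc t htm) c hu
  have hd := (hω.isSmoothForm htm).extD
  have hi1 := (integrableOn_innerDensity hd hηs.extD c hgs hg).const_mul 2
  have hi2 := (integrableOn_innerDensity hd hd c hgs hg).const_mul C
  rw [← integral_const_mul, ← integral_const_mul, ← integral_add hi1 hi2]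
  refine setIntegral_mono_on hint (hi1.add hi2) hV.measurableSet fun u hu => ?_
  -- The pointwise bound is available only on the compact support of the cutoff; elsewhere both
  -- sides vanish.
  by_cases huK : u ∈ cutoffSupport m c
  · obtain ⟨D, hD, hle⟩ := hC t ht η hηs hη u huK
    rw [(hD.const_mul (cutoff c u)).deriv]
    calc cutoff c u * D ≤ cutoff c u * _ := mul_le_mul_of_nonneg_left hle (cutoff_nonneg c u)
      _ = _ := by ring
  · simp [f, cutoff_eq_zero c hu huK]

/-- Grönwall's inequality for the energy `E`. The evolution equation enters only through the sign of
the pairing of `dω` with `d(∂_t ω)`. -/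
theorem extD_eq_zero_of_flow {T : ℝ} (hT : 0 < T) {ω : ℝ → FormField m 2 M}
    {J : ℝ → EndoField m M} (hω : IsSmoothFormFamily (Icc 0 T) ω)
    (hJ : IsSmoothEndoFamily (Icc 0 T) J)
    (hc : ∀ t ∈ Icc 0 T, IsCompatiblePair (ω t) (J t)) (h0 : extD (ω 0) = 0)
    (hevol : ∀ t ∈ Ioo 0 T, ∃ γ : FormField m 2 M,
      IsCodifferential (metric (ω t) (J t)) (extD (ω t)) γ ∧
      ∀ (x : M) (v : Fin 2 → Tan m x), HasDerivAt (fun s => ω s x v) (-(γ x v)) t) :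
    extD (ω T) = 0 := by
  obtain ⟨s, -, hs⟩ := exists_l2Inner_eq_sum m M
  choose C hC using exists_hasDerivAt_energy_le hT hω hJ hc
  -- A common growth constant for the finitely many charts; enlarging `C c` to `B` is harmless since
  -- each local energy is nonnegative.
  obtain ⟨B, hB⟩ := (s.image C).exists_le
  replace hB : ∀ c ∈ s, C c ≤ B := fun c hcs => hB _ (Finset.mem_image_of_mem C hcs)
  let E : ℝ → ℝ := fun t => l2Inner (metric (ω t) (J t)) (extD (ω t)) (extD (ω t))
  have hpos : ∀ t ∈ Icc 0 T, ∀ c : M, ∀ u ∈ (chart m c).target,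
      (chartGram c (metric (ω t) (J t)) u).PosDef :=
    fun t ht c u hu => chartGram_posDef (hc t ht) c hu
  have hE : E = fun t => ∑ c ∈ s, ∫ u in (chart m c).target, cutoff c u *
      innerDensity c (metric (ω t) (J t)) (extD (ω t)) (extD (ω t)) u :=
    funext fun t => hs _ _ _ _
  have hEcont : ContinuousOn E (Icc 0 T) := by
    rw [hE]
    refine continuousOn_finsetSum _ fun c _ => ?_
    refine continuousOn_setIntegral_of_isCompact_support (f := fun q : ℝ × Model m =>
      cutoff c q.2 * innerDensity c (metric (ω q.1) (J q.1)) (extD (ω q.1)) (extD (ω q.1)) q.2)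
      isCompact_Icc (isOpen_chart_target c) (isCompact_cutoffSupport c)
      (cutoffSupport_subset c) ?_ fun t u hu h => by rw [cutoff_eq_zero c hu h, zero_mul]
    exact ((contDiffOn_cutoff c).comp contDiff_snd.contDiffOn fun q hq => hq.2).continuousOn.mul
      (contDiffOn_innerDensity_family hω hJ hc
        (contDiffOn_chartForm_extD (uniqueDiffOn_Icc hT) hω) c).continuousOn
  have hEderiv : ∀ t ∈ Ioo 0 T, ∃ D : ℝ, HasDerivAt E D t ∧ D ≤ B * E t := by
    intro t ht
    have htm : t ∈ Icc 0 T := Ioo_subset_Icc_self ht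
    obtain ⟨γ, ⟨hγs, hγ⟩, hderiv⟩ := hevol t ht
    choose D hD hDle using fun c => hC c t ht (-γ) hγs.neg hderiv
    refine ⟨∑ c ∈ s, D c, hE ▸ HasDerivAt.fun_sum fun c _ => hD c, ?_⟩
    -- The codifferential tested on `-γ`: `(dω, d(-γ)) = (γ, -γ) = -(γ, γ)`.
    have hnonpos : l2Inner (metric (ω t) (J t)) (extD (ω t)) (extD (-γ)) ≤ 0 := by
      rw [← hγ (-γ) hγs.neg, hs]
      simp only [innerDensity_neg_right, mul_neg, integral_neg, Finset.sum_neg_distrib]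
      rw [← hs, neg_nonpos]
      exact l2Inner_self_nonneg (hpos t htm) γ
    have hEt : E t = ∑ c ∈ s, ∫ u in (chart m c).target, cutoff c u *
      innerDensity c (metric (ω t) (J t)) (extD (ω t)) (extD (ω t)) u := congrFun hE t
    rw [hs] at hnonpos
    calc ∑ c ∈ s, D c ≤ ∑ c ∈ s, (2 * (∫ u in (chart m c).target, cutoff c u *
            innerDensity c (metric (ω t) (J t)) (extD (ω t)) (extD (-γ)) u) +
          B * ∫ u in (chart m c).target, cutoff c u *
            innerDensity c (metric (ω t) (J t)) (extD (ω t)) (extD (ω t)) u) :=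
          Finset.sum_le_sum fun c hcs => (hDle c).trans <| add_le_add_right
            (mul_le_mul_of_nonneg_right (hB c hcs)
              (setIntegral_innerDensity_self_nonneg (hpos t htm c) _)) _
      _ ≤ B * E t := by
          rw [Finset.sum_add_distrib, ← Finset.mul_sum, ← Finset.mul_sum, ← hEt]
          linarith
  have hE0 : E 0 = 0 := by
    simp only [E, h0, hs, innerDensity_zero_left, mul_zero, integral_zero, Finset.sum_const_zero]
  -- The integrating factor `exp(-Bt)` turns `E' ≤ B E` into monotonicity; with `E 0 = 0` this
  -- forces `E T ≤ 0`.
  have hanti : AntitoneOn (fun t => Real.exp (-B * t) * E t) (Icc 0 T) := by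
    have hd : ∀ t ∈ Ioo 0 T, ∃ D : ℝ, HasDerivAt (fun t => Real.exp (-B * t) * E t) D t ∧
        D ≤ 0 := by
      intro t ht
      obtain ⟨D, hD, hle⟩ := hEderiv t ht
      refine ⟨_, ((((hasDerivAt_id t).const_mul (-B)).exp).mul hD), ?_⟩
      have := Real.exp_pos (-B * t)
      simp only [id]
      nlinarith
    refine antitoneOn_of_deriv_nonpos (convex_Icc 0 T) (by fun_prop) ?_ ?_
    · rw [interior_Icc]
      intro t ht
      obtain ⟨D, hD, -⟩ := hd t ht
      exact hD.differentiableAt.differentiableWithinAt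
    · rw [interior_Icc]
      intro t ht
      obtain ⟨D, hD, hle⟩ := hd t ht
      rwa [hD.deriv]
  have hTm : T ∈ Icc 0 T := right_mem_Icc.2 hT.le
  have hle := hanti (left_mem_Icc.2 hT.le) hTm hT.le
  simp only [hE0, mul_zero] at hle
  have hET : E T ≤ 0 := by
    by_contra! h
    exact absurd hle (not_le.2 (mul_pos (Real.exp_pos _) h))
  exact eq_zero_of_l2Inner_self (hω.isSmoothForm hTm).extD
    (fun c => contDiffOn_chartGram_metric hω hJ hTm c) (hpos T hTm)
    (le_antisymm hET (l2Inner_self_nonneg (hpos T hTm) _))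

end Energy

/-! ### Vanishing of `d^*dω` and reduction of the flow -/

section Flow

variable {m p : ℕ} {M : Type*} [TopologicalSpace M] [ChartedSpace (Model m) M]

theorem fieldK_zero (ω : FormField m 2 M) (J : EndoField m M) (x : M) (v : Tan m x) :
    fieldK ω J 0 x v = 0 := by
  simp [fieldK, raise]

variable [T2Space M] [CompactSpace M] [IsManifold 𝓘(ℝ, Model m) ((⊤ : ℕ∞) : WithTop ℕ∞) M]

theorem l2Inner_zero_left (g : BilinField m M) (β : FormField m p M) : l2Inner g 0 β = 0 := by
  obtain ⟨s, -, hs⟩ := exists_l2Inner_eq_sum m M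
  simp [hs, innerDensity_zero_left]

theorem isCodifferential_zero (g : BilinField m M) :
    IsCodifferential g (0 : FormField m (p + 1) M) 0 :=
  ⟨isSmoothForm_zero, fun β _ => by rw [l2Inner_zero_left, l2Inner_zero_left]⟩

/-- The `d^* d`-Ricci flow preserves closedness of the two-form. -/
theorem IsDStarDRicciFlow.extD_eq_zero {S : Set ℝ} (hS : S.OrdConnected) (hS0 : IsLeast S 0)
    {ω : ℝ → FormField m 2 M} {J : ℝ → EndoField m M} (h : IsDStarDRicciFlow S ω J)
    (h0 : extD (ω 0) = 0) {t : ℝ} (ht : t ∈ S) : extD (ω t) = 0 := by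
  rcases (hS0.2 ht).eq_or_lt with rfl | hpos
  · exact h0
  have hsub : Icc 0 t ⊆ S := hS.out hS0.1 ht
  refine extD_eq_zero_of_flow hpos (fun c => (h.smooth_form c).mono (prod_mono_left hsub))
    (fun c => (h.smooth_endo c).mono (prod_mono_left hsub)) (fun s hs => h.compatible s (hsub hs))
    h0 fun s hs => ?_
  obtain ⟨γ, h1, h2, -⟩ := h.evolution s (hsub (Ioo_subset_Icc_self hs))
  exact ⟨γ, h1, fun x v => ((h2 x v).mono hsub).hasDerivAt (Icc_mem_nhds hs.1 hs.2)⟩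

/-- The codifferential of the zero form vanishes. -/
theorem IsCodifferential.eq_zero {ω : ℝ → FormField m 2 M} {J : ℝ → EndoField m M} {S : Set ℝ}
    (hω : IsSmoothFormFamily S ω) (hJ : IsSmoothEndoFamily S J) {t : ℝ} (ht : t ∈ S)
    (hc : IsCompatiblePair (ω t) (J t)) {γ : FormField m p M}
    (h : IsCodifferential (metric (ω t) (J t)) 0 γ) : γ = 0 :=
  eq_zero_of_l2Inner_self h.1 (fun c => contDiffOn_chartGram_metric hω hJ ht c)
    -- Testing on `γ` itself: `(γ, γ) = (0, dγ) = 0`.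
    (fun c _ hu => chartGram_posDef hc c hu) (by rw [h.2 γ h.1, l2Inner_zero_left])

end Flow

end AlmostHermitian

theorem mainTheorem10 {m : ℕ} {M : Type*} [TopologicalSpace M] [T2Space M] [CompactSpace M]
    [ChartedSpace (Model m) M] [IsManifold 𝓘(ℝ, Model m) ((⊤ : ℕ∞) : WithTop ℕ∞) M]
    (S : Set ℝ) (hS : S.OrdConnected) (hS0 : IsLeast S 0) (hS1 : S.Nontrivial)
    (ω : ℝ → FormField m 2 M) (J : ℝ → EndoField m M) (hclosed : extD (ω 0) = 0) :
    IsDStarDRicciFlow S ω J ↔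
      (∀ t ∈ S, ω t = ω 0) ∧ IsAntiComplexifiedRicciFlow S (ω 0) J := by
  constructor
  · intro h
    have hzero : ∀ t ∈ S, IsCodifferential (metric (ω t) (J t)) (extD (ω t)) 0 ∧
        (∀ (x : M) (v : Fin 2 → Tan m x), HasDerivWithinAt (fun s => ω s x v) 0 S t) ∧
        (∀ (x : M) (v : Tan m x),
          HasDerivWithinAt (fun s => J s x v) (fieldB (ω t) (J t) x v) S t) := by
      intro t ht
      obtain ⟨γ, h1, h2, h3⟩ := h.evolution t ht
      have hγ : γ = 0 := by
        rw [h.extD_eq_zero hS hS0 hclosed ht] at h1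
        exact IsCodifferential.eq_zero h.smooth_form h.smooth_endo ht (h.compatible t ht) h1
      subst hγ
      simp only [fieldK_zero, zero_add] at h3
      exact ⟨h1, fun x v => by simpa using h2 x v, h3⟩
    have hconst : ∀ t ∈ S, ω t = ω 0 := by
      intro t ht
      funext x
      ext v
      have hsub : Icc 0 t ⊆ S := hS.out hS0.1 ht
      have hd : ∀ s ∈ Icc 0 t, HasDerivWithinAt (fun s => ω s x v) 0 (Icc 0 t) s :=
        fun s hs => ((hzero s (hsub hs)).2.1 x v).mono hsub
      refine constant_of_derivWithin_zero (fun s hs => (hd s hs).differentiableWithinAt)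
        (fun s hs => ?_) t (right_mem_Icc.2 (hS0.2 ht))
      -- A point `s` of `Ico 0 t` forces `0 < t`, so derivatives within `Icc 0 t` are unique; for `t
      -- = 0` there is nothing to check.
      exact (hd s (Ico_subset_Icc_self hs)).derivWithin
        (uniqueDiffOn_Icc (hs.1.trans_lt hs.2) s (Ico_subset_Icc_self hs))
    refine ⟨hconst, h.smooth_form.isSmoothForm hS0.1, hclosed, h.smooth_endo,
      fun t ht => hconst t ht ▸ h.compatible t ht, fun t ht => ?_⟩
    have := (hzero t ht).2.2
    rwa [hconst t ht] at this
  · rintro ⟨hconst, h⟩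
    refine ⟨fun c => ?_, h.smooth_endo, fun t ht => hconst t ht ▸ h.compatible t ht,
      fun t ht => ⟨0, ?_, fun x v => ?_, fun x v => ?_⟩⟩
    -- The family equals `ω 0` only for times in `S`, so smoothness, and below the time derivative,
    -- are transferred by congruence on `S`.
    · refine ContDiffOn.congr (f := fun q : ℝ × Model m => chartForm c (ω 0) q.2)
        ((h.smooth_form c).comp contDiff_snd.contDiffOn fun q hq => hq.2) fun q hq => ?_
      simp only [hconst q.1 hq.1]
    · rw [hconst t ht, hclosed]
      exact isCodifferential_zero _
    · refine (hasDerivWithinAt_const t S (ω 0 x v)).congr_of_mem (fun s hs => ?_) ht |>.congr_deriv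
        (by simp)
      rw [hconst s hs]
    · rw [fieldK_zero, zero_add, hconst t ht]
      exact h.evolution t ht x v
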